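/- Let $J_1\ge 0$ be fixed, $I=(0,1)$, $S^1\subset\mathbb R^2$ the unit circle, $B_1\subset\mathbb R^2$ the closed unit ball, $(\cdot,\cdot)$ the scalar product of $\mathbb R^2$. For $N\in\mathbb N$ and $v:\{0,\dots,N\}\to S^1$ put $$\mathcal E_N(v)=-J_1\sum_{i=0}^{N-2}(v^i,v^{i+1})+\sum_{i=0}^{N-2}(v^i,v^{i+2}),$$ and let $\overline{\mathcal U}_N$ be the set of those $v$ with $(v^1,v^0)=(v^N,v^{N-1})$. Given positive numbers $\lambda_n\to0$, let $N_n=[1/\lambda_n]$ and (for $n$ so large that $\lambda_n\le1$) define $E_n:L^\infty(I,\mathbb R^2)\to(-\infty,+\infty]$ by $E_n(u)=\lambda_n\mathcal E_{N_n}(v)$ if there is $v\in\overline{\mathcal U}_{N_n}$ with $u=v^i$ a.e. on $I\cap\lambda_n(i+[0,1))$ for $i=0,\dots,N_n$, and $E_n(u)=+\infty$ otherwise. (If $\lambda_nN_n=1$, then $v^{N_n}$ is not determined by $u$, and the infimum over the possible $v$ is taken.) **Theorem.** There is a convex function $f_{hom}:B_1\to\mathbb R$, depending only on $J_1$, such that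 for every $z\in B_1$ $$f_{hom}(z)=\lim_{\rho\to0^+}\lim_{k\to\infty}\frac1k\inf\Big\{\mathcal E_k(v)\,:\,v\in\overline{\mathcal U}_k,\ \frac1{k-1}\sum_{i=1}^{k-1}v^i\in\overline B(z,\rho)\Big\},$$ where the limits exist and are finite, and such that for every sequence of positive numbers $\lambda_n\to0$ the functionals $E_n$ $\Gamma$-converge, with respect to the weak-$*$ convergence of sequences in $L^\infty(I,\mathbb R^2)$, to $$E(u)=\begin{cases}\int_I f_{hom}(u(x))\,dx&\text{if }|u|\le1\text{ a.e. in } I,\\+\infty&\text{otherwise in }L^\infty(I,\mathbb R^2),\end{cases}$$ where the integral converges whenever $|u|\le 1$ a.e. Furthermore: (i) if $J_1\ge4$, then $f_{hom}(z)=-(J_1-1)$ for all $z\in B_1$; (ii) if $0<J_1\le4$, then for all $z\in B_1$ $$\frac{(J_1-4)^2}{8}|z|^2\le f_{hom}(z)+1+\frac{J_1^2}{8}\le\frac{(J_1-4)^2}{8}|z|,$$ and there is a convex nondecreasing function $h:[0,1]\to\mathbb R$ with $f_{hom}(z)=h(|z|)$ for all $z\in B_1$; (iii) if $0<J_1\le4$,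 then $\min E=E(0)=-\big(1+\frac{J_1^2}{8}\big)$. -/

import Mathlib

open MeasureTheory Filter Topology

noncomputable section

namespace SpinChain

/-- The plane `ℝ²` with its Euclidean norm and scalar product. -/
abbrev Plane : Type := EuclideanSpace ℝ (Fin 2)

/-- The unit circle `S¹ ⊂ ℝ²`. -/
abbrev Circle1 : Type := Metric.sphere (0 : Plane) 1

/-- Lebesgue measure on the interval `I = (0,1)`. -/
abbrev volI : Measure ℝ := volume.restrict (Set.Ioo (0 : ℝ) 1)

/-- The space `L^∞(I, ℝ²)`. -/
abbrev LInfI : Type := Lp Plane ⊤ volI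

/-- A spin configuration on the lattice points `0, 1, …, N`. It is given as a function on `ℕ`; only
its values at `0, …, N` enter the notions below. -/
abbrev Spins : Type := ℕ → Circle1

/-- The boundary condition `(u¹, u⁰) = (u^N, u^{N-1})` on the lattice `{0, …, N}`. -/
def PeriodicBC (N : ℕ) (v : Spins) : Prop :=
  inner ℝ (v 1 : Plane) (v 0 : Plane) = inner ℝ (v N : Plane) (v (N - 1) : Plane)

/-- The unscaled energy of a chain on `{0, …, N}`:
`-J₁ ∑_{i=0}^{N-2} (uⁱ, u^{i+1}) + ∑_{i=0}^{N-2} (uⁱ, u^{i+2})`. -/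
def chainEnergy (J₁ : ℝ) (N : ℕ) (v : Spins) : ℝ :=
  -J₁ * ∑ i ∈ Finset.range (N - 1), inner ℝ (v i : Plane) (v (i + 1) : Plane)
    + ∑ i ∈ Finset.range (N - 1), inner ℝ (v i : Plane) (v (i + 2) : Plane)

/-- The piecewise constant interpolation of `v`, equal to `vⁱ` on the cell `lam (i + [0,1))`. -/
def interp (lam : ℝ) (v : Spins) (x : ℝ) : Plane := (v ⌊x / lam⌋₊ : Plane)

/-- The energy `E_n` on `L^∞(I, ℝ²)` for the lattice spacing `lam = λ_n`, with `N = [1/λ_n]`: it is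
`λ_n * chainEnergy J₁ N v` if `u` is (a.e.) the interpolation of a configuration `v` that satisfies
the boundary condition, and `+∞` (an infimum over the empty set) if there is no such `v`.
The values `v⁰, …, v^N` are determined by `u`, with the exception of `v^N` when `lam * N = 1`,
because the last cell does not meet `I` in that case; the infimum is then over the possible `v^N`. -/
def energy (J₁ lam : ℝ) (u : LInfI) : EReal :=
  ⨅ (v : Spins) (_ : PeriodicBC ⌊1 / lam⌋₊ v) (_ : (u : ℝ → Plane) =ᵐ[volI] interp lam v),
    ((lam * chainEnergy J₁ ⌊1 / lam⌋₊ v : ℝ) : EReal)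

/-- The discrete average of `v` over `ℤ ∩ (0,k) = {1, …, k-1}`. -/
def average (k : ℕ) (v : Spins) : Plane :=
  ((Finset.Ioo 0 k).card : ℝ)⁻¹ • ∑ i ∈ Finset.Ioo 0 k, (v i : Plane)

/-- The minimum problem of the homogenization formula on `(0,k)`: `1/k` times the infimum of the
chain energy over the configurations on `{0, …, k}` with the boundary condition and with average in
the closed ball `B(z,ρ)` (`+∞` if there are none). -/
def cellInf (J₁ : ℝ) (z : Plane) (ρ : ℝ) (k : ℕ) : EReal :=
  ⨅ (v : Spins) (_ : PeriodicBC k v) (_ : average k v ∈ Metric.closedBall z ρ),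
    ((chainEnergy J₁ k v / k : ℝ) : EReal)

/-- `c = lim_{ρ → 0⁺} lim_{k → ∞} cellInf J₁ z ρ k`, where all the limits exist and are finite. -/
def IsHomLimit (J₁ : ℝ) (z : Plane) (c : ℝ) : Prop :=
  ∃ g : ℝ → ℝ,
    (∀ ρ : ℝ, 0 < ρ → Tendsto (fun k : ℕ => cellInf J₁ z ρ k) atTop (𝓝 ((g ρ : ℝ) : EReal))) ∧
      Tendsto g (𝓝[>] 0) (𝓝 c)

/-- Weak-* convergence in `L^∞(I, ℝ²)`, as the dual of `L¹(I, ℝ²)`. -/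
def WeakStarTendsto (u : ℕ → LInfI) (w : LInfI) : Prop :=
  ∀ g : ℝ → Plane, Integrable g volI →
    Tendsto (fun n => ∫ x, inner ℝ (u n x) (g x) ∂volI) atTop (𝓝 (∫ x, inner ℝ (w x) (g x) ∂volI))

/-- `F` is the `Γ`-limit of the functionals `Fn` with respect to weak-* convergence in
`L^∞(I, ℝ²)`: the liminf inequality along every converging sequence, and for every point the
existence of a recovery sequence. -/
def IsGammaLimit (Fn : ℕ → LInfI → EReal) (F : LInfI → EReal) : Prop :=
  (∀ (w : LInfI) (u : ℕ → LInfI), WeakStarTendsto u w →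
      F w ≤ liminf (fun n => Fn n (u n)) atTop) ∧
    ∀ w : LInfI, ∃ u : ℕ → LInfI, WeakStarTendsto u w ∧
      limsup (fun n => Fn n (u n)) atTop ≤ F w

open Classical in
/-- The functional `u ↦ ∫_I f(u(x)) dx` if `|u| ≤ 1` a.e., and `+∞` otherwise. -/
def bulkEnergy (f : Plane → ℝ) (u : LInfI) : EReal :=
  if ∀ᵐ x ∂volI, ‖u x‖ ≤ 1 then ((∫ x, f (u x) ∂volI : ℝ) : EReal) else ⊤

end SpinChain

end

/-
The energy of a block of spins, counted with the bonds that leave it, is sub-additive up to a fixed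
cost per interface. Putting blocks in a row therefore makes the closure of the set of pairs
(mean spin, energy per spin + interface cost) convex, and it is the epigraph of `f_hom`. The liminf
inequality and the recovery sequences come from cutting the chain into `M` long blocks: the block
means approach the means of the weak-* limit over `M` cells. As `M → ∞`, lower semicontinuity of
`f_hom` gives the liminf inequality, and Jensen's inequality bounds the energy of recovery
sequences.

For the bounds, completing the square in every triple of consecutive spins `x, y, z` turns the
energy per spin into the mean of `½ |x - (J₁/2) y + z|² - (1 + J₁²/8)`. Convexity of the square
gives the lower bound; the helix with angle `arccos (J₁/4)` attains it at `0`, and convexity of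
`f_hom` between the helix and the constant chains gives the upper bound.
-/

noncomputable section

namespace SpinChain

/-! ### Sub-additivity of the energy -/

/-- The energy of the two bonds that start at the lattice point `i`. -/
def bondEnergy (J : ℝ) (v : Spins) (i : ℕ) : ℝ :=
  -J * inner ℝ (v i : Plane) (v (i + 1) : Plane) + inner ℝ (v i : Plane) (v (i + 2) : Plane)

/-- The energy of the bonds that start at `0, …, n - 1`. Unlike `chainEnergy J n`, it counts the
bonds that leave the block `0, …, n - 1`, which makes it additive under translations. -/
def partialEnergy (J : ℝ) (n : ℕ) (v : Spins) : ℝ := ∑ i ∈ Finset.range n, bondEnergy J v i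

/-- The sum of the first `n` spins. -/
def spinSum (n : ℕ) (v : Spins) : Plane := ∑ i ∈ Finset.range n, (v i : Plane)

/-- The mean of the first `n` spins, with the value `0` for `n = 0`. -/
def meanSpin (n : ℕ) (v : Spins) : Plane := (n : ℝ)⁻¹ • spinSum n v

/-- The configuration equal to `v` on `0, …, m - 1`, followed by `w`. -/
def concat (m : ℕ) (v w : Spins) : Spins := fun i => if i < m then v i else w (i - m)

/-- The configuration `v` read from the lattice point `s` on. -/
def shift (s : ℕ) (v : Spins) : Spins := fun i => v (s + i)

/-- The price charged for every interface between blocks of spins. It dominates the energy of the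
bonds across the interface and is large enough to absorb the boundary terms in the lower bounds of
the energy of a block as well. -/
def interfaceCost (J : ℝ) : ℝ := 8 * (|J| + 1) ^ 2

section HomogenizedDensity

variable {J : ℝ}

lemma chainEnergy_eq_partialEnergy (J : ℝ) (N : ℕ) (v : Spins) :
    chainEnergy J N v = partialEnergy J (N - 1) v := by
  simp only [chainEnergy, partialEnergy, bondEnergy, Finset.mul_sum, Finset.sum_add_distrib]

lemma four_mul_le_interfaceCost (J : ℝ) : 4 * (|J| + 1) ≤ interfaceCost J := by
  unfold interfaceCost
  nlinarith [abs_nonneg J]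

lemma interfaceCost_nonneg (J : ℝ) : 0 ≤ interfaceCost J := by
  unfold interfaceCost
  positivity

lemma norm_spin (x : Circle1) : ‖(x : Plane)‖ = 1 := mem_sphere_zero_iff_norm.1 x.2

lemma abs_inner_spin_le (x y : Circle1) : |inner ℝ (x : Plane) (y : Plane)| ≤ 1 := by
  simpa only [norm_spin, mul_one] using abs_real_inner_le_norm (x : Plane) (y : Plane)

lemma abs_bondEnergy_le (J : ℝ) (v : Spins) (i : ℕ) : |bondEnergy J v i| ≤ |J| + 1 := by
  refine (abs_add_le _ _).trans (add_le_add ?_ (abs_inner_spin_le _ _))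
  rw [abs_mul, abs_neg]
  exact mul_le_of_le_one_right (abs_nonneg J) (abs_inner_spin_le _ _)

lemma partialEnergy_zero (J : ℝ) (v : Spins) : partialEnergy J 0 v = 0 := Finset.sum_range_zero _

lemma partialEnergy_succ (J : ℝ) (n : ℕ) (v : Spins) :
    partialEnergy J (n + 1) v = partialEnergy J n v + bondEnergy J v n :=
  Finset.sum_range_succ _ _

lemma partialEnergy_add (J : ℝ) (m n : ℕ) (v : Spins) :
    partialEnergy J (m + n) v = partialEnergy J m v + partialEnergy J n (shift m v) :=
  Finset.sum_range_add _ _ _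

lemma abs_partialEnergy_le (J : ℝ) (n : ℕ) (v : Spins) :
    |partialEnergy J n v| ≤ n * (|J| + 1) := by
  refine (Finset.abs_sum_le_sum_abs _ _).trans ?_
  simpa only [Finset.card_range, nsmul_eq_mul] using
    Finset.sum_le_card_nsmul (Finset.range n) _ _ fun i _ => abs_bondEnergy_le J v i

lemma spinSum_zero (v : Spins) : spinSum 0 v = 0 := Finset.sum_range_zero _

lemma spinSum_succ (n : ℕ) (v : Spins) : spinSum (n + 1) v = spinSum n v + v n :=
  Finset.sum_range_succ _ _

lemma spinSum_add (m n : ℕ) (v : Spins) :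
    spinSum (m + n) v = spinSum m v + spinSum n (shift m v) :=
  Finset.sum_range_add _ _ _

lemma spinSum_congr {n : ℕ} {v w : Spins} (h : ∀ i < n, v i = w i) :
    spinSum n v = spinSum n w :=
  Finset.sum_congr rfl fun i hi => by rw [h i (Finset.mem_range.1 hi)]

lemma norm_spinSum_le (n : ℕ) (v : Spins) : ‖spinSum n v‖ ≤ n := by
  refine (norm_sum_le _ _).trans_eq ?_
  simp only [norm_spin, Finset.sum_const, Finset.card_range, nsmul_eq_mul, mul_one]

lemma natCast_smul_meanSpin (n : ℕ) (v : Spins) : (n : ℝ) • meanSpin n v = spinSum n v := by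
  rcases eq_or_ne n 0 with rfl | hn
  · rw [Nat.cast_zero, zero_smul, spinSum_zero]
  · exact smul_inv_smul₀ (Nat.cast_ne_zero.2 hn) _

lemma norm_meanSpin_le (n : ℕ) (v : Spins) : ‖meanSpin n v‖ ≤ 1 := by
  rw [meanSpin, norm_smul, norm_inv, Real.norm_natCast]
  exact inv_mul_le_one_of_le₀ (norm_spinSum_le n v) n.cast_nonneg

lemma abs_partialEnergy_sub_le (J : ℝ) {n : ℕ} {v w : Spins} (h : ∀ i < n, v i = w i) :
    |partialEnergy J n v - partialEnergy J n w| ≤ 4 * (|J| + 1) := by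
  obtain ⟨k, r, rfl, hr, hk⟩ : ∃ k r, n = k + r ∧ r ≤ 2 ∧ ∀ i < k, i + 2 < n :=
    ⟨n - 2, n - (n - 2), by omega, by omega, by omega⟩
  have hinterior : partialEnergy J k v = partialEnergy J k w := by
    refine Finset.sum_congr rfl fun i hi => ?_
    have hi := hk i (Finset.mem_range.1 hi)
    rw [bondEnergy, bondEnergy, h i (by omega), h (i + 1) (by omega), h (i + 2) hi]
  have hlast : ∀ u : Spins, |partialEnergy J r u| ≤ 2 * (|J| + 1) := fun u =>
    (abs_partialEnergy_le J r u).trans (by gcongr; exact_mod_cast hr)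
  rw [partialEnergy_add, partialEnergy_add, hinterior, add_sub_add_left_eq_sub]
  exact (abs_sub _ _).trans (by linarith [hlast (shift k v), hlast (shift k w)])

lemma concat_of_lt {m i : ℕ} (v w : Spins) (h : i < m) : concat m v w i = v i := if_pos h

lemma shift_concat (m : ℕ) (v w : Spins) : shift m (concat m v w) = w := by
  funext i
  simp [shift, concat]

lemma spinSum_concat (m n : ℕ) (v w : Spins) :
    spinSum (m + n) (concat m v w) = spinSum m v + spinSum n w := by
  rw [spinSum_add, shift_concat, spinSum_congr fun i hi => concat_of_lt v w hi]

lemma partialEnergy_concat_le (J : ℝ) (m n : ℕ) (v w : Spins) :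
    partialEnergy J (m + n) (concat m v w) ≤
      partialEnergy J m v + partialEnergy J n w + interfaceCost J := by
  have h := abs_le.1 (abs_partialEnergy_sub_le J (n := m) fun i hi => concat_of_lt v w hi)
  rw [partialEnergy_add, shift_concat]
  linarith [four_mul_le_interfaceCost J]

/-! ### The homogenized energy density -/

/-- The triples (length, sum of the spins, upper bound of the energy, including the cost of an
interface) that are realized by a configuration. They form a semigroup because configurations can
be put in a row. -/
def realizable (J : ℝ) : AddSubsemigroup (ℕ × Plane × ℝ) where
  carrier := {p | ∃ v, spinSum p.1 v = p.2.1 ∧ partialEnergy J p.1 v + interfaceCost J ≤ p.2.2}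
  add_mem' := by
    rintro p q ⟨v, hv, hv'⟩ ⟨w, hw, hw'⟩
    refine ⟨concat p.1 v w, ?_, ?_⟩
    · simp only [Prod.fst_add, Prod.snd_add, spinSum_concat, hv, hw]
    · simp only [Prod.fst_add, Prod.snd_add]
      linarith [partialEnergy_concat_le J p.1 q.1 v w]

lemma nsmul_mem_of_pos {M : Type*} [AddMonoid M] {S : AddSubsemigroup M} {p : M} (hp : p ∈ S)
    {k : ℕ} (hk : 0 < k) : k • p ∈ S := by
  induction k, hk using Nat.le_induction with
  | base => rwa [one_nsmul]
  | succ k _ ih => rw [succ_nsmul]; exact S.add_mem ih hp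

/-- The pairs (mean spin, energy density) of finite configurations. -/
def densitySet (J : ℝ) : Set (Plane × ℝ) :=
  {p | ∃ n : ℕ, 0 < n ∧ (n, (n : ℝ) • p) ∈ realizable J}

/-- The closed epigraph of the homogenized energy density. -/
def homEpigraph (J : ℝ) : Set (Plane × ℝ) := closure (densitySet J)

lemma isClosed_homEpigraph (J : ℝ) : IsClosed (homEpigraph J) := isClosed_closure

lemma midpoint_mem_densitySet {p q : Plane × ℝ} (hp : p ∈ densitySet J) (hq : q ∈ densitySet J) :
    midpoint ℝ p q ∈ densitySet J := by
  obtain ⟨m, hm, hmp⟩ := hp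
  obtain ⟨n, hn, hnq⟩ := hq
  refine ⟨n * m + m * n, by positivity, ?_⟩
  convert (realizable J).add_mem (nsmul_mem_of_pos hmp hn) (nsmul_mem_of_pos hnq hm) using 1
  refine Prod.ext rfl ?_
  simp only [midpoint_eq_smul_add, invOf_eq_inv, Prod.snd_add, Prod.smul_snd,
    ← Nat.cast_smul_eq_nsmul ℝ]
  push_cast
  module

lemma convex_of_isClosed_of_midpoint_mem {E : Type*} [AddCommGroup E] [Module ℝ E]
    [TopologicalSpace E] [IsTopologicalAddGroup E] [ContinuousSMul ℝ E] {s : Set E}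
    (hs : IsClosed s) (hmid : ∀ x ∈ s, ∀ y ∈ s, midpoint ℝ x y ∈ s) : Convex ℝ s := by
  rw [convex_iff_segment_subset]
  intro x hx y hy
  rw [segment_eq_image_lineMap]
  rintro _ ⟨t, ht, rfl⟩
  by_contra hts
  set T : Set ℝ := AffineMap.lineMap (k := ℝ) x y ⁻¹' s
  have hT : IsClosed T := hs.preimage AffineMap.lineMap_continuous
  -- The midpoint of a maximal open interval around `t` that avoids `T` lies in `T`.
  obtain ⟨a, ⟨ha, hat⟩, hamax⟩ := (isCompact_Icc.inter_left hT).exists_isGreatest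
    (s := T ∩ Set.Icc 0 t) ⟨0, by simpa [T] using hx, le_rfl, ht.1⟩
  obtain ⟨b, ⟨hb, htb⟩, hbmin⟩ := (isCompact_Icc.inter_left hT).exists_isLeast
    (s := T ∩ Set.Icc t 1) ⟨1, by simpa [T] using hy, ht.2, le_rfl⟩
  have hat' : a < t := hat.2.lt_of_ne (by rintro rfl; exact hts ha)
  have htb' : t < b := htb.1.lt_of_ne (by rintro rfl; exact hts hb)
  have hm : 2⁻¹ * (a + b) ∈ T := by
    have := hmid _ ha _ hb
    rwa [← AffineMap.map_midpoint, midpoint_eq_smul_add, invOf_eq_inv, smul_eq_mul] at this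
  rcases le_total (2⁻¹ * (a + b)) t with h | h
  · linarith [hamax ⟨hm, by linarith [hat.1], h⟩]
  · linarith [hbmin ⟨hm, h, by linarith [htb.2]⟩]

lemma convex_homEpigraph (J : ℝ) : Convex ℝ (homEpigraph J) :=
  convex_of_isClosed_of_midpoint_mem (isClosed_homEpigraph J) fun _ hp _ hq =>
    map_mem_closure₂ (f := fun p q : Plane × ℝ => midpoint ℝ p q)
      (by simp only [midpoint_eq_smul_add]; fun_prop) hp hq
      fun _ hx _ hy => midpoint_mem_densitySet hx hy

lemma homEpigraph_subset {K : Set (Plane × ℝ)} (hK : IsClosed K)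
    (h : ∀ n : ℕ, 0 < n → ∀ v t, partialEnergy J n v + interfaceCost J ≤ n * t →
      (meanSpin n v, t) ∈ K) : homEpigraph J ⊆ K := by
  refine closure_minimal ?_ hK
  rintro ⟨z, t⟩ ⟨n, hn, v, hv, hv'⟩
  have hz : meanSpin n v = z := by
    rw [meanSpin, hv]
    exact inv_smul_smul₀ (Nat.cast_ne_zero.2 hn.ne') z
  exact hz ▸ h n hn v t hv'

lemma meanSpin_mem_homEpigraph {n : ℕ} (hn : 0 < n) {v : Spins} {t : ℝ}
    (h : partialEnergy J n v + interfaceCost J ≤ n * t) : (meanSpin n v, t) ∈ homEpigraph J :=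
  subset_closure ⟨n, hn, v, (natCast_smul_meanSpin n v).symm, h⟩

lemma mem_homEpigraph_of_tendsto {v : Spins} {z : Plane} {t c : ℝ}
    (hz : Tendsto (fun n => meanSpin n v) atTop (𝓝 z))
    (ht : ∀ n : ℕ, partialEnergy J n v ≤ n * t + c) : (z, t) ∈ homEpigraph J := by
  have hlim : Tendsto (fun n : ℕ => t + (c + interfaceCost J) / n) atTop (𝓝 t) := by
    simpa using (tendsto_const_div_atTop_nhds_zero_nat (c + interfaceCost J)).const_add t
  refine (isClosed_homEpigraph J).mem_of_tendsto (hz.prodMk_nhds hlim) ?_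
  filter_upwards [eventually_gt_atTop 0] with n hn
  refine meanSpin_mem_homEpigraph hn ?_
  rw [mul_add, mul_div_cancel₀ _ (Nat.cast_ne_zero.2 hn.ne')]
  linarith [ht n]

lemma neg_le_of_mem_homEpigraph {p : Plane × ℝ} (h : p ∈ homEpigraph J) : -(|J| + 1) ≤ p.2 := by
  refine homEpigraph_subset (K := {p | -(|J| + 1) ≤ p.2})
    (isClosed_le continuous_const continuous_snd) (fun n hn v t ht => ?_) h
  refine le_of_mul_le_mul_left (a := (n : ℝ)) ?_ (Nat.cast_pos.2 hn)
  linarith [neg_le_of_abs_le (abs_partialEnergy_le J n v), interfaceCost_nonneg J]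

lemma homEpigraph_mono {z : Plane} {s t : ℝ} (h : (z, s) ∈ homEpigraph J) (hst : s ≤ t) :
    (z, t) ∈ homEpigraph J := by
  have hK : IsClosed ((fun p : Plane × ℝ => (p.1, p.2 + (t - s))) ⁻¹' homEpigraph J) :=
    (isClosed_homEpigraph J).preimage (by fun_prop)
  simpa using homEpigraph_subset hK (fun n hn v r hr => meanSpin_mem_homEpigraph hn
    (t := r + (t - s)) (hr.trans (by gcongr; linarith))) h

lemma mem_homEpigraph_of_norm_eq_one (J : ℝ) {e : Plane} (he : ‖e‖ = 1) :
    (e, 1 - J) ∈ homEpigraph J := by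
  let v : Spins := fun _ => ⟨e, mem_sphere_zero_iff_norm.2 he⟩
  refine mem_homEpigraph_of_tendsto (v := v) (c := 0) ?_ fun n => ?_
  · refine tendsto_const_nhds.congr' ?_
    filter_upwards [eventually_ne_atTop 0] with n hn
    simp [meanSpin, spinSum, v, ← Nat.cast_smul_eq_nsmul ℝ, smul_smul, hn]
  · refine le_of_eq ?_
    simp [partialEnergy, bondEnergy, v, he]
    ring

lemma exists_norm_one_smul (z : Plane) : ∃ e : Plane, ‖e‖ = 1 ∧ z = ‖z‖ • e := by
  rcases eq_or_ne z 0 with rfl | hz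
  · exact ⟨EuclideanSpace.single 0 1, by simp, by simp⟩
  · exact ⟨‖z‖⁻¹ • z, norm_smul_inv_norm hz, (smul_inv_smul₀ (norm_ne_zero_iff.2 hz) z).symm⟩

lemma mem_homEpigraph_of_norm_le_one (J : ℝ) {z : Plane} (hz : ‖z‖ ≤ 1) :
    (z, 1 - J) ∈ homEpigraph J := by
  obtain ⟨e, he, hze⟩ := exists_norm_one_smul z
  have h := convex_homEpigraph J (mem_homEpigraph_of_norm_eq_one J he)
    (mem_homEpigraph_of_norm_eq_one J (e := -e) (by rwa [norm_neg]))
    (a := (1 + ‖z‖) / 2) (b := (1 - ‖z‖) / 2) (by positivity) (by linarith) (by ring)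
  convert h using 1
  refine Prod.ext ?_ ?_
  · simp only [Prod.smul_mk, Prod.mk_add_mk]
    nth_rewrite 1 [hze]
    module
  · simp only [Prod.smul_mk, Prod.mk_add_mk, smul_eq_mul]
    ring

/-- The homogenized energy density. Only its values on the closed unit ball are meaningful;
elsewhere it is the infimum of the empty set, which is `0`. -/
def homDensity (J : ℝ) (z : Plane) : ℝ := sInf {t | (z, t) ∈ homEpigraph J}

lemma homDensity_le_iff {z : Plane} (hz : ‖z‖ ≤ 1) {t : ℝ} :
    homDensity J z ≤ t ↔ (z, t) ∈ homEpigraph J := by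
  have hb : BddBelow {t | (z, t) ∈ homEpigraph J} := ⟨_, fun t ht => neg_le_of_mem_homEpigraph ht⟩
  have hc : IsClosed {t | (z, t) ∈ homEpigraph J} :=
    (isClosed_homEpigraph J).preimage (by fun_prop)
  exact ⟨homEpigraph_mono (hc.csInf_mem ⟨_, mem_homEpigraph_of_norm_le_one J hz⟩ hb),
    fun h => csInf_le hb h⟩

lemma homDensity_mem_homEpigraph (J : ℝ) {z : Plane} (hz : ‖z‖ ≤ 1) :
    (z, homDensity J z) ∈ homEpigraph J := (homDensity_le_iff hz).1 le_rfl

lemma homDensity_le (J : ℝ) {z : Plane} (hz : ‖z‖ ≤ 1) : homDensity J z ≤ 1 - J :=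
  (homDensity_le_iff hz).2 (mem_homEpigraph_of_norm_le_one J hz)

lemma abs_homDensity_le (J : ℝ) {z : Plane} (hz : ‖z‖ ≤ 1) : |homDensity J z| ≤ |J| + 1 :=
  abs_le.2 ⟨neg_le_of_mem_homEpigraph (homDensity_mem_homEpigraph J hz),
    (homDensity_le J hz).trans (by linarith [neg_le_abs J])⟩

lemma homDensity_meanSpin_le (J : ℝ) (n : ℕ) (v : Spins) :
    n * homDensity J (meanSpin n v) ≤ partialEnergy J n v + interfaceCost J := by
  rcases n.eq_zero_or_pos with rfl | hn
  · simpa [partialEnergy_zero] using interfaceCost_nonneg J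
  · rw [← le_div_iff₀' (Nat.cast_pos.2 hn), homDensity_le_iff (norm_meanSpin_le n v)]
    exact meanSpin_mem_homEpigraph hn (by rw [mul_div_cancel₀ _ (Nat.cast_ne_zero.2 hn.ne')])

lemma convexOn_homDensity (J : ℝ) :
    ConvexOn ℝ (Metric.closedBall (0 : Plane) 1) (homDensity J) := by
  refine ⟨convex_closedBall _ _, fun x hx y hy a b ha hb hab => ?_⟩
  have hxy := convex_closedBall (0 : Plane) 1 hx hy ha hb hab
  rw [mem_closedBall_zero_iff] at hx hy hxy
  rw [homDensity_le_iff hxy]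
  exact convex_homEpigraph J (homDensity_mem_homEpigraph J hx) (homDensity_mem_homEpigraph J hy)
    ha hb hab

lemma lowerSemicontinuousOn_homDensity (J : ℝ) :
    LowerSemicontinuousOn (homDensity J) (Metric.closedBall 0 1) := by
  intro z hz t ht
  rw [mem_closedBall_zero_iff] at hz
  have hopen : IsOpen {y : Plane | (y, t) ∉ homEpigraph J} :=
    ((isClosed_homEpigraph J).preimage (f := fun y : Plane => (y, t)) (by fun_prop)).isOpen_compl
  have hmem : (z, t) ∉ homEpigraph J := fun h => ht.not_ge ((homDensity_le_iff hz).2 h)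
  filter_upwards [mem_nhdsWithin_of_mem_nhds (hopen.mem_nhds hmem), self_mem_nhdsWithin]
    with y hy hball
  exact lt_of_not_ge fun hle => hy ((homDensity_le_iff (mem_closedBall_zero_iff.1 hball)).1 hle)

/-! ### Blocks of prescribed length -/

lemma exists_forall_ge_block {m : ℕ} (hm : 0 < m) {p : Plane × ℝ}
    (hp : (m, (m : ℝ) • p) ∈ realizable J) :
    ∃ D : ℝ, ∀ n ≥ m, ∃ v, ‖spinSum n v - (n : ℝ) • p.1‖ ≤ D ∧
      partialEnergy J n v + interfaceCost J ≤ n * p.2 + D := by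
  have ⟨w, _⟩ := hp
  obtain ⟨D, hD⟩ := ((Finset.range m).image fun r => max ‖spinSum r w - (r : ℝ) • p.1‖
    (partialEnergy J r w + interfaceCost J - r * p.2)).exists_le
  refine ⟨D, fun n hn => ?_⟩
  have hr := hD _ (Finset.mem_image_of_mem _ (Finset.mem_range.2 (n.mod_lt hm)))
  obtain ⟨v, hv, hv'⟩ := (realizable J).add_mem (nsmul_mem_of_pos hp (Nat.div_pos hn hm))
    (show (n % m, spinSum (n % m) w, partialEnergy J (n % m) w + interfaceCost J) ∈ realizable J
      from ⟨w, rfl, le_rfl⟩)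
  have hn' : n / m * m + n % m = n := Nat.div_add_mod' n m
  have hnR : ((n / m : ℕ) : ℝ) * m = n - (n % m : ℕ) := by
    rw [eq_sub_iff_add_eq]; exact_mod_cast hn'
  simp only [Prod.fst_add, Prod.snd_add, Prod.smul_fst, Prod.smul_snd, smul_eq_mul, hn',
    ← Nat.cast_smul_eq_nsmul ℝ, smul_smul, hnR] at hv hv'
  refine ⟨v, ?_, ?_⟩
  · rw [hv]
    calc ‖((n : ℝ) - (n % m : ℕ)) • p.1 + spinSum (n % m) w - (n : ℝ) • p.1‖
        = ‖spinSum (n % m) w - ((n % m : ℕ) : ℝ) • p.1‖ := by congr 1; module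
      _ ≤ D := (le_max_left _ _).trans hr
  · linarith [(le_max_right _ _).trans hr]

lemma eventually_exists_block {z : Plane} {t : ℝ} (h : (z, t) ∈ homEpigraph J) {ε : ℝ}
    (hε : 0 < ε) : ∀ᶠ n : ℕ in atTop, ∃ v, ‖spinSum n v - (n : ℝ) • z‖ ≤ ε * n ∧
      partialEnergy J n v + interfaceCost J ≤ n * (t + ε) := by
  obtain ⟨p, ⟨m, hm, hp⟩, hd⟩ := Metric.mem_closure_iff.1 h (ε / 2) (half_pos hε)
  rw [Prod.dist_eq, max_lt_iff, dist_comm, dist_eq_norm, Real.dist_eq, abs_lt] at hd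
  obtain ⟨hdz, hdt, -⟩ := hd
  obtain ⟨D, hD⟩ := exists_forall_ge_block hm hp
  filter_upwards [eventually_ge_atTop m,
    tendsto_natCast_atTop_atTop.eventually_ge_atTop (2 * D / ε)] with n hn hnD
  obtain ⟨v, hv, hv'⟩ := hD n hn
  have hDn : D ≤ ε / 2 * n := by
    rw [div_le_iff₀ hε] at hnD
    linarith
  refine ⟨v, ?_, hv'.trans ?_⟩
  · calc ‖spinSum n v - (n : ℝ) • z‖
        = ‖(spinSum n v - (n : ℝ) • p.1) + (n : ℝ) • (p.1 - z)‖ := by congr 1; module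
      _ ≤ D + n * (ε / 2) := by
        refine norm_add_le_of_le hv ?_
        rw [norm_smul, Real.norm_natCast]
        gcongr
      _ ≤ ε * n := by linarith
  · have : (n : ℝ) * p.2 ≤ n * (t + ε / 2) := by gcongr; linarith
    linarith

/-! ### Bounds of the homogenized energy density -/

/-- The energy `-J/2 ((x, y) + (y, z)) + (x, z)` of three consecutive spins: every bond between
neighbours is shared by the two triples that contain it. -/
def tripleEnergy (J : ℝ) (v : Spins) (i : ℕ) : ℝ :=
  -(J / 2) * (inner ℝ (v i : Plane) (v (i + 1) : Plane)
    + inner ℝ (v (i + 1) : Plane) (v (i + 2) : Plane)) + inner ℝ (v i : Plane) (v (i + 2) : Plane)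

/-- The combination `x - (J/2) y + z` of three consecutive spins. For `|J| ≤ 4` it vanishes exactly
on the triples of least energy, which turn by `arccos (J/4)` twice in the same direction. -/
def helixDefect (J : ℝ) (v : Spins) (i : ℕ) : Plane :=
  v i - (J / 2) • (v (i + 1) : Plane) + v (i + 2)

lemma abs_partialEnergy_sub_sum_tripleEnergy_le (J : ℝ) (n : ℕ) (v : Spins) :
    |partialEnergy J n v - ∑ i ∈ Finset.range n, tripleEnergy J v i| ≤ |J| := by
  have htelescope : partialEnergy J n v - ∑ i ∈ Finset.range n, tripleEnergy J v i =
      J / 2 * (inner ℝ (v n : Plane) (v (n + 1) : Plane)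
        - inner ℝ (v 0 : Plane) (v 1 : Plane)) := by
    rw [partialEnergy, ← Finset.sum_sub_distrib,
      ← Finset.sum_range_sub (fun i => inner ℝ (v i : Plane) (v (i + 1) : Plane)), Finset.mul_sum]
    exact Finset.sum_congr rfl fun i _ => by rw [bondEnergy, tripleEnergy]; ring
  have hends := (abs_sub (inner ℝ (v n : Plane) (v (n + 1) : Plane)) _).trans
    (add_le_add (abs_inner_spin_le _ _) (abs_inner_spin_le (v 0) (v 1)))
  rw [htelescope, abs_mul, abs_div, abs_two]
  nlinarith [abs_nonneg J]

lemma norm_helixDefect_sq (J : ℝ) (v : Spins) (i : ℕ) :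
    ‖helixDefect J v i‖ ^ 2 = 2 * tripleEnergy J v i + 2 * (1 + J ^ 2 / 8) := by
  rw [helixDefect, tripleEnergy, norm_add_sq_real, norm_sub_sq_real, inner_sub_left,
    real_inner_smul_left, real_inner_smul_right, norm_smul, norm_spin, norm_spin, norm_spin,
    mul_pow, Real.norm_eq_abs, sq_abs]
  ring

lemma norm_sum_helixDefect_sub_le (J : ℝ) (n : ℕ) (v : Spins) :
    ‖∑ i ∈ Finset.range n, helixDefect J v i - (2 - J / 2) • spinSum n v‖ ≤ |J| + 4 := by
  have htelescope : ∑ i ∈ Finset.range n, helixDefect J v i - (2 - J / 2) • spinSum n v =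
      (J / 2) • (v 0 - v n : Plane) + ((v n - v 0 : Plane) + (v (n + 1) - v 1 : Plane)) := by
    induction n with
    | zero => simp [spinSum_zero]
    | succ n ih =>
      rw [Finset.sum_range_succ, spinSum_succ, helixDefect]
      linear_combination (norm := module) ih
  have hdiff : ∀ i j, ‖(v i - v j : Plane)‖ ≤ 2 := fun i j =>
    (norm_sub_le _ _).trans_eq (by rw [norm_spin, norm_spin]; norm_num)
  rw [htelescope]
  refine (norm_add_le_of_le ?_ (norm_add_le_of_le (hdiff n 0) (hdiff (n + 1) 1))).trans_eq
    (by norm_num : |J| + (2 + 2) = |J| + 4)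
  rw [norm_smul, Real.norm_eq_abs, abs_div, abs_two]
  nlinarith [abs_nonneg J, hdiff 0 n]

lemma quadratic_le_partialEnergy (J : ℝ) (n : ℕ) (v : Spins) :
    n * ((J - 4) ^ 2 / 8 * ‖meanSpin n v‖ ^ 2 - (1 + J ^ 2 / 8)) ≤
      partialEnergy J n v + interfaceCost J := by
  set z := meanSpin n v
  set c := 2 - J / 2 with hc
  have henergy := neg_le_of_abs_le (abs_partialEnergy_sub_sum_tripleEnergy_le J n v)
  -- `|d|² / 2 ≥ (c z, d) - |c z|² / 2` for every defect `d`, and the defects average to `≈ c z`.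
  have htriple : ∀ i, inner ℝ (c • z) (helixDefect J v i) - c ^ 2 * ‖z‖ ^ 2 / 2 - (1 + J ^ 2 / 8) ≤
      tripleEnergy J v i := fun i => by
    have h := norm_sub_sq_real (c • z) (helixDefect J v i)
    rw [norm_helixDefect_sq, norm_smul, mul_pow, Real.norm_eq_abs, sq_abs] at h
    linarith [sq_nonneg ‖c • z - helixDefect J v i‖]
  have hsum := Finset.sum_le_sum fun i (_ : i ∈ Finset.range n) => htriple i
  simp only [Finset.sum_sub_distrib, Finset.sum_const, Finset.card_range, nsmul_eq_mul,
    ← inner_sum] at hsum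
  have hdefect : c ^ 2 * (n * ‖z‖ ^ 2) - (2 + |J| / 2) * (|J| + 4) ≤
      inner ℝ (c • z) (∑ i ∈ Finset.range n, helixDefect J v i) := by
    have hcz : ‖c • z‖ ≤ 2 + |J| / 2 := by
      rw [norm_smul, Real.norm_eq_abs]
      have : |c| ≤ 2 + |J| / 2 := (abs_sub _ _).trans_eq (by rw [abs_div, abs_two])
      nlinarith [norm_meanSpin_le n v, abs_nonneg J, norm_nonneg z]
    have h := neg_le_of_abs_le ((abs_real_inner_le_norm (c • z) _).trans
      (mul_le_mul hcz (norm_sum_helixDefect_sub_le J n v) (norm_nonneg _) (by positivity)))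
    rw [inner_sub_right, ← natCast_smul_meanSpin, ← hc, real_inner_smul_left _ (c • _),
      real_inner_smul_right, real_inner_smul_right, real_inner_self_eq_norm_sq] at h
    linarith
  have hcost : (2 + |J| / 2) * (|J| + 4) + |J| ≤ interfaceCost J := by
    unfold interfaceCost
    nlinarith [abs_nonneg J]
  rw [show (J - 4) ^ 2 / 8 = c ^ 2 / 2 by rw [hc]; ring]
  linarith

lemma quadratic_le_homDensity (J : ℝ) {z : Plane} (hz : ‖z‖ ≤ 1) :
    (J - 4) ^ 2 / 8 * ‖z‖ ^ 2 ≤ homDensity J z + (1 + J ^ 2 / 8) := by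
  have hK : IsClosed {p : Plane × ℝ | (J - 4) ^ 2 / 8 * ‖p.1‖ ^ 2 - (1 + J ^ 2 / 8) ≤ p.2} :=
    isClosed_le (by fun_prop) (by fun_prop)
  have h := homEpigraph_subset hK (fun n hn v t ht => ?_) (homDensity_mem_homEpigraph J hz)
  · simp only [Set.mem_ofPred_eq] at h
    linarith
  · exact le_of_mul_le_mul_left ((quadratic_le_partialEnergy J n v).trans ht) (Nat.cast_pos.2 hn)

lemma one_sub_le_tripleEnergy (hJ : 4 ≤ J) (v : Spins) (i : ℕ) : 1 - J ≤ tripleEnergy J v i := by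
  have h4 := norm_helixDefect_sq 4 v i
  have hnear := (abs_le.1 (abs_inner_spin_le (v i) (v (i + 1)))).2
  have hnear' := (abs_le.1 (abs_inner_spin_le (v (i + 1)) (v (i + 2)))).2
  unfold tripleEnergy at h4 ⊢
  nlinarith [sq_nonneg ‖helixDefect 4 v i‖]

lemma homDensity_eq_of_four_le (hJ : 4 ≤ J) {z : Plane} (hz : ‖z‖ ≤ 1) :
    homDensity J z = -(J - 1) := by
  rw [neg_sub]
  refine le_antisymm (homDensity_le J hz) (homEpigraph_subset (K := {p | 1 - J ≤ p.2})
    (isClosed_le continuous_const continuous_snd) (fun n hn v t ht => ?_)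
    (homDensity_mem_homEpigraph J hz))
  have hsum := Finset.card_nsmul_le_sum (Finset.range n) _ _
    fun i _ => one_sub_le_tripleEnergy hJ v i
  rw [Finset.card_range, nsmul_eq_mul] at hsum
  refine le_of_mul_le_mul_left (a := (n : ℝ)) ?_ (Nat.cast_pos.2 hn)
  linarith [neg_le_of_abs_le (abs_partialEnergy_sub_sum_tripleEnergy_le J n v),
    four_mul_le_interfaceCost J, abs_nonneg J]

/-- The configuration that turns by the angle `φ` from each lattice point to the next. -/
def helix (φ : ℝ) : Spins := fun i =>
  ⟨!₂[Real.cos (i * φ), Real.sin (i * φ)], by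
    simp [EuclideanSpace.norm_eq, Fin.sum_univ_two]⟩

lemma helixDefect_helix (φ : ℝ) (i : ℕ) : helixDefect (4 * Real.cos φ) (helix φ) i = 0 := by
  have h₀ : (i : ℝ) * φ = (i + 1) * φ - φ := by ring
  have h₂ : ((i : ℝ) + 2) * φ = (i + 1) * φ + φ := by ring
  ext j
  fin_cases j <;>
  · simp only [helixDefect, helix, Nat.cast_add, Nat.cast_one, Nat.cast_ofNat, h₀, h₂]
    simp [Real.cos_add, Real.cos_sub, Real.sin_add, Real.sin_sub]
    ring

lemma tendsto_meanSpin_helix {φ : ℝ} (hφ : Real.cos φ ≠ 1) :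
    Tendsto (fun n => meanSpin n (helix φ)) atTop (𝓝 0) := by
  set c := 2 - 4 * Real.cos φ / 2
  have hc : 0 < ‖c‖ := norm_pos_iff.2 fun h => hφ (by simp only [c] at h; linarith)
  have hsum : ∀ n, ‖spinSum n (helix φ)‖ ≤ (|4 * Real.cos φ| + 4) / ‖c‖ := fun n => by
    have h := norm_sum_helixDefect_sub_le (4 * Real.cos φ) n (helix φ)
    rw [Finset.sum_eq_zero fun i _ => helixDefect_helix φ i, zero_sub, norm_neg, norm_smul] at h
    rwa [le_div_iff₀' hc]
  refine squeeze_zero_norm (fun n => ?_)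
    (tendsto_const_div_atTop_nhds_zero_nat ((|4 * Real.cos φ| + 4) / ‖c‖))
  rw [meanSpin, norm_smul, norm_inv, Real.norm_natCast, ← div_eq_inv_mul]
  gcongr
  exact hsum n

lemma homDensity_zero (hJ : |J| ≤ 4) : homDensity J 0 = -(1 + J ^ 2 / 8) := by
  obtain ⟨hJ₁, hJ₂⟩ := abs_le.1 hJ
  refine le_antisymm ?_ ?_
  · rcases eq_or_ne J 4 with rfl | hne
    · exact (homDensity_le 4 (by simp)).trans_eq (by norm_num)
    have hcos : Real.cos (Real.arccos (J / 4)) = J / 4 :=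
      Real.cos_arccos (by linarith) (by linarith)
    rw [homDensity_le_iff (by simp)]
    refine mem_homEpigraph_of_tendsto (c := |J|)
      (tendsto_meanSpin_helix (φ := Real.arccos (J / 4))
        (by rw [hcos]; exact fun h => hne (by linarith))) fun n => ?_
    have htriple : ∀ i, tripleEnergy J (helix (Real.arccos (J / 4))) i = -(1 + J ^ 2 / 8) :=
      fun i => by
        have hdefect := helixDefect_helix (Real.arccos (J / 4)) i
        rw [hcos, mul_div_cancel₀ J (by norm_num : (4 : ℝ) ≠ 0)] at hdefect
        have h := norm_helixDefect_sq J (helix (Real.arccos (J / 4))) i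
        rw [hdefect, norm_zero] at h
        linarith
    have h := le_of_abs_le
      (abs_partialEnergy_sub_sum_tripleEnergy_le J n (helix (Real.arccos (J / 4))))
    simp only [htriple, Finset.sum_const, Finset.card_range, nsmul_eq_mul] at h
    linarith
  · have h := quadratic_le_homDensity J (z := 0) (by simp)
    rw [norm_zero] at h
    linarith

lemma homDensity_le_linear (hJ : |J| ≤ 4) {z : Plane} (hz : ‖z‖ ≤ 1) :
    homDensity J z + (1 + J ^ 2 / 8) ≤ (J - 4) ^ 2 / 8 * ‖z‖ := by
  obtain ⟨e, he, hze⟩ := exists_norm_one_smul z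
  have h := (convexOn_homDensity J).2 (x := e) (by simp [he]) (y := 0) (by simp)
    (norm_nonneg z) (sub_nonneg.2 hz) (by ring)
  rw [smul_zero, add_zero, ← hze, homDensity_zero hJ, smul_eq_mul, smul_eq_mul] at h
  linarith [mul_le_mul_of_nonneg_left (homDensity_le J he.le) (norm_nonneg z)]

/-- The image of a configuration under an isometry of the plane. -/
def mapSpins (R : Plane ≃ₗᵢ[ℝ] Plane) (v : Spins) : Spins := fun i => ⟨R (v i), by simp⟩

lemma map_mem_homEpigraph (R : Plane ≃ₗᵢ[ℝ] Plane) {z : Plane} {t : ℝ}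
    (h : (z, t) ∈ homEpigraph J) : (R z, t) ∈ homEpigraph J := by
  have hK : IsClosed ((fun p : Plane × ℝ => (R p.1, p.2)) ⁻¹' homEpigraph J) :=
    (isClosed_homEpigraph J).preimage ((R.continuous.comp continuous_fst).prodMk continuous_snd)
  refine homEpigraph_subset hK (fun n hn v s hs => ?_) h
  have henergy : partialEnergy J n (mapSpins R v) = partialEnergy J n v := by
    simp only [partialEnergy, bondEnergy, mapSpins, LinearIsometryEquiv.inner_map_map]
  have hmean : meanSpin n (mapSpins R v) = R (meanSpin n v) := by
    simp only [meanSpin, spinSum, mapSpins, map_smul, map_sum]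
  change (R (meanSpin n v), s) ∈ homEpigraph J
  exact hmean ▸ meanSpin_mem_homEpigraph hn (henergy.symm ▸ hs)

lemma homDensity_eq_of_norm_eq (J : ℝ) {z w : Plane} (h : ‖z‖ = ‖w‖) :
    homDensity J z = homDensity J w := by
  have hmem : ∀ {x y : Plane}, ‖x‖ = ‖y‖ → ∀ {t}, (x, t) ∈ homEpigraph J → (y, t) ∈ homEpigraph J :=
    fun {x y} hxy t ht => by
      simpa only [Submodule.reflection_sub hxy] using
        map_mem_homEpigraph (Submodule.reflection (ℝ ∙ (x - y))ᗮ) ht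
  exact congrArg sInf (Set.ext fun t => ⟨hmem h, hmem h.symm⟩)

lemma exists_convexOn_monotoneOn_of_radial {E : Type*} [NormedAddCommGroup E] [NormedSpace ℝ E]
    [Nontrivial E] {f : E → ℝ} (hconv : ConvexOn ℝ (Metric.closedBall 0 1) f)
    (hrad : ∀ x y, ‖x‖ = ‖y‖ → f x = f y) :
    ∃ h : ℝ → ℝ, ConvexOn ℝ (Set.Icc 0 1) h ∧ MonotoneOn h (Set.Icc 0 1) ∧ ∀ z, f z = h ‖z‖ := by
  obtain ⟨e, he⟩ := exists_norm_eq E zero_le_one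
  have hnorm : ∀ r : ℝ, ‖r • e‖ = |r| := fun r => by rw [norm_smul, he, mul_one, Real.norm_eq_abs]
  have hline : ConvexOn ℝ (Set.Icc (-1) 1) fun r : ℝ => f (r • e) := by
    refine (hconv.comp_linearMap (LinearMap.toSpanSingleton ℝ E e)).subset (fun r hr => ?_)
      (convex_Icc _ _)
    simpa [hnorm, abs_le] using hr
  refine ⟨fun r => f (r • e), hline.subset (Set.Icc_subset_Icc (by norm_num) le_rfl)
    (convex_Icc _ _), fun a ha b hb hab => ?_, fun z => hrad _ _ (by rw [hnorm, abs_norm])⟩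
  have hseg : a ∈ segment ℝ (-b) b := by
    rw [segment_eq_Icc (by linarith [hb.1])]
    exact ⟨by linarith [ha.1, hb.1], hab⟩
  have h := hline.le_on_segment (x := -b) (y := b) ⟨by linarith [hb.2], by linarith [hb.1]⟩
    ⟨by linarith [hb.1], hb.2⟩ hseg
  rwa [hrad ((-b) • e) (b • e) (by rw [hnorm, hnorm, abs_neg]), max_self] at h

/-! ### The homogenization formula -/

lemma exists_inner_eq (a : Circle1) {c : ℝ} (hc : |c| ≤ 1) :
    ∃ b : Circle1, inner ℝ (b : Plane) (a : Plane) = c := by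
  have hrank : 1 < Module.rank ℝ Plane := by
    rw [← Module.finrank_eq_rank, finrank_euclideanSpace_fin]
    exact_mod_cast one_lt_two
  have haa : inner ℝ (a : Plane) (a : Plane) = 1 := by
    rw [real_inner_self_eq_norm_sq, norm_spin, one_pow]
  have hIcc := (isPreconnected_sphere hrank (0 : Plane) 1).intermediate_value (-a).2 a.2
    (f := fun b => inner ℝ b (a : Plane)) (by fun_prop)
  obtain ⟨b, hb, hbc⟩ := hIcc (by simpa [haa] using abs_le.1 hc : c ∈ _)
  exact ⟨⟨b, hb⟩, hbc⟩

lemma exists_periodicBC {N : ℕ} (hN : 2 ≤ N) (v : Spins) :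
    ∃ w, PeriodicBC N w ∧ ∀ i, i ≠ N → w i = v i := by
  obtain ⟨b, hb⟩ := exists_inner_eq (v (N - 1)) (abs_inner_spin_le (v 1) (v 0))
  refine ⟨Function.update v N b, ?_, fun i hi => Function.update_of_ne hi _ _⟩
  rw [PeriodicBC, Function.update_self, Function.update_of_ne (by omega),
    Function.update_of_ne (by omega), Function.update_of_ne (by omega), hb]

lemma average_eq_meanSpin (k : ℕ) (v : Spins) : average k v = meanSpin (k - 1) (shift 1 v) := by
  rw [average, Nat.card_Ioo, Nat.sub_zero, show Finset.Ioo 0 k = Finset.Ico 1 k from rfl,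
    Finset.sum_Ico_eq_sum_range]
  rfl

lemma abs_chainEnergy_sub_partialEnergy_shift_le (J : ℝ) (k : ℕ) (v : Spins) :
    |chainEnergy J k v - partialEnergy J (k - 1) (shift 1 v)| ≤ 2 * (|J| + 1) := by
  have hadd := partialEnergy_add J 1 (k - 1) v
  rw [add_comm 1, partialEnergy_succ] at hadd
  have hfirst := abs_partialEnergy_le J 1 v
  have hlast := abs_bondEnergy_le J v (k - 1)
  rw [chainEnergy_eq_partialEnergy,
    show partialEnergy J (k - 1) v - partialEnergy J (k - 1) (shift 1 v) =
      partialEnergy J 1 v - bondEnergy J v (k - 1) by linarith]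
  exact (abs_sub _ _).trans (by push_cast at hfirst; linarith)

lemma tendsto_pred_mul_add_div (a b : ℝ) :
    Tendsto (fun k : ℕ => (((k - 1 : ℕ) : ℝ) * a + b) / k) atTop (𝓝 a) := by
  have h := (tendsto_const_nhds (x := a)).add (tendsto_const_div_atTop_nhds_zero_nat (b - a))
  rw [add_zero] at h
  refine h.congr' ?_
  filter_upwards [eventually_gt_atTop 0] with k hk
  rw [Nat.cast_pred hk]
  field_simp
  ring

lemma le_cellInf (J : ℝ) {z : Plane} {ρ g : ℝ}
    (hg : ∀ w ∈ Metric.closedBall z ρ ∩ Metric.closedBall 0 1, g ≤ homDensity J w) (k : ℕ) :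
    (((((k - 1 : ℕ) : ℝ) * g + -(interfaceCost J + 2 * (|J| + 1))) / k : ℝ) : EReal) ≤
      cellInf J z ρ k := by
  refine le_iInf₂ fun v _ => le_iInf fun hv => EReal.coe_le_coe_iff.2 ?_
  rw [average_eq_meanSpin] at hv
  gcongr
  have hgv := mul_le_mul_of_nonneg_left (hg _ ⟨hv, mem_closedBall_zero_iff.2
    (norm_meanSpin_le _ _)⟩) (Nat.cast_nonneg (α := ℝ) (k - 1))
  linarith [homDensity_meanSpin_le J (k - 1) (shift 1 v),
    neg_le_of_abs_le (abs_chainEnergy_sub_partialEnergy_shift_le J k v)]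

lemma eventually_cellInf_le {z w : Plane} {ρ ε : ℝ} (hw : ‖w‖ ≤ 1) (hε : 0 < ε)
    (hwz : ‖w - z‖ + ε ≤ ρ) : ∀ᶠ k in atTop, cellInf J z ρ k ≤
      (((((k - 1 : ℕ) : ℝ) * (homDensity J w + ε) + 2 * (|J| + 1)) / k : ℝ) : EReal) := by
  filter_upwards [(tendsto_sub_atTop_nat 1).eventually
    (eventually_exists_block (homDensity_mem_homEpigraph J hw) hε), eventually_ge_atTop 2]
    with k ⟨v, hvsum, hvenergy⟩ hk
  obtain ⟨u, hu, huv⟩ := exists_periodicBC hk (concat 1 v v)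
  have huv : ∀ i < k - 1, shift 1 u i = v i := fun i hi =>
    (huv _ (by omega)).trans (congrFun (shift_concat 1 v v) i)
  have hpos : (0 : ℝ) < (k - 1 : ℕ) := Nat.cast_pos.2 (by omega)
  refine iInf₂_le_of_le u hu (iInf_le_of_le ?_ (EReal.coe_le_coe_iff.2 ?_))
  · have hmean : ‖meanSpin (k - 1) v - w‖ ≤ ε := by
      refine le_of_mul_le_mul_left ?_ hpos
      rwa [← norm_smul_of_nonneg hpos.le, smul_sub, natCast_smul_meanSpin, mul_comm _ ε]
    rw [average_eq_meanSpin, meanSpin, spinSum_congr huv, ← meanSpin, mem_closedBall_iff_norm]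
    linarith [norm_sub_le_norm_sub_add_norm_sub (meanSpin (k - 1) v) w z]
  · gcongr
    linarith [le_of_abs_le (abs_chainEnergy_sub_partialEnergy_shift_le J k u),
      le_of_abs_le (abs_partialEnergy_sub_le J huv), four_mul_le_interfaceCost J]

lemma exists_norm_sub_lt_of_convexOn {E : Type*} [NormedAddCommGroup E] [NormedSpace ℝ E]
    {s : Set E} {f : E → ℝ} (hf : ConvexOn ℝ s f) {w z : E} {r ρ : ℝ} (hw : w ∈ s) (hz : z ∈ s)
    (hρ : 0 < ρ) (hwz : ‖w - z‖ ≤ ρ) (hwr : f w < r) : ∃ y ∈ s, ‖y - z‖ < ρ ∧ f y < r := by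
  have hlim : Tendsto (fun t : ℝ => (1 - t) * f w + t * f z) (𝓝[>] 0) (𝓝 (f w)) := by
    have : Continuous fun t : ℝ => (1 - t) * f w + t * f z := by fun_prop
    simpa using (this.tendsto 0).mono_left nhdsWithin_le_nhds
  obtain ⟨t, htr, ht0, ht1⟩ :=
    ((hlim.eventually_lt_const hwr).and (Ioc_mem_nhdsGT one_pos)).exists
  refine ⟨(1 - t) • w + t • z, hf.1 hw hz (sub_nonneg.2 ht1) ht0.le (sub_add_cancel _ _), ?_,
    (hf.2 hw hz (sub_nonneg.2 ht1) ht0.le (sub_add_cancel _ _)).trans_lt htr⟩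
  rw [show (1 - t) • w + t • z - z = (1 - t) • (w - z) by module, norm_smul,
    Real.norm_of_nonneg (sub_nonneg.2 ht1)]
  nlinarith

lemma tendsto_sInf_image_closedBall {X : Type*} [PseudoMetricSpace X] {s : Set X} {f : X → ℝ}
    {z : X} (hz : z ∈ s) (hf : LowerSemicontinuousWithinAt f s z) (hbdd : BddBelow (f '' s)) :
    Tendsto (fun ρ => sInf (f '' (Metric.closedBall z ρ ∩ s))) (𝓝[>] 0) (𝓝 (f z)) := by
  have hmem : ∀ {ρ : ℝ}, 0 < ρ → f z ∈ f '' (Metric.closedBall z ρ ∩ s) := fun hρ =>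
    Set.mem_image_of_mem f ⟨Metric.mem_closedBall_self hρ.le, hz⟩
  refine tendsto_order.2 ⟨fun a ha => ?_, fun a ha => ?_⟩
  · obtain ⟨b, hab, hb⟩ := exists_between ha
    obtain ⟨δ, hδ, hδb⟩ := Metric.mem_nhdsWithin_iff.1 (hf b hb)
    filter_upwards [Ioo_mem_nhdsGT hδ] with ρ hρ
    refine hab.trans_le (le_csInf ⟨_, hmem hρ.1⟩ ?_)
    rintro _ ⟨y, hy, rfl⟩
    exact (hδb ⟨Metric.closedBall_subset_ball hρ.2 hy.1, hy.2⟩).le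
  · filter_upwards [self_mem_nhdsWithin] with ρ hρ
    exact (csInf_le (hbdd.mono (Set.image_mono Set.inter_subset_right)) (hmem hρ)).trans_lt ha

lemma bddBelow_image_homDensity (J : ℝ) :
    BddBelow (homDensity J '' Metric.closedBall (0 : Plane) 1) := by
  refine ⟨-(|J| + 1), ?_⟩
  rintro _ ⟨w, hw, rfl⟩
  exact neg_le_of_abs_le (abs_homDensity_le J (mem_closedBall_zero_iff.1 hw))

lemma tendsto_cellInf {z : Plane} (hz : z ∈ Metric.closedBall (0 : Plane) 1) {ρ : ℝ}
    (hρ : 0 < ρ) : Tendsto (cellInf J z ρ) atTop (𝓝 ((sInf (homDensity J ''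
      (Metric.closedBall z ρ ∩ Metric.closedBall 0 1)) : ℝ) : EReal)) := by
  refine tendsto_order.2 ⟨fun a ha => ?_, fun a ha => ?_⟩
  · have hbdd := (bddBelow_image_homDensity J).mono (Set.image_mono
      (Set.inter_subset_right (s := Metric.closedBall z ρ)))
    filter_upwards [((continuous_coe_real_ereal.tendsto _).comp
      (tendsto_pred_mul_add_div _ _)).eventually_const_lt ha] with k hk
    exact hk.trans_le (le_cellInf J (fun w hw => csInf_le hbdd ⟨w, hw, rfl⟩) k)
  · obtain ⟨r, hr, hra⟩ := EReal.lt_iff_exists_real_btwn.1 ha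
    have hne : (homDensity J '' (Metric.closedBall z ρ ∩ Metric.closedBall 0 1)).Nonempty :=
      ⟨_, z, ⟨Metric.mem_closedBall_self hρ.le, hz⟩, rfl⟩
    obtain ⟨_, ⟨w, hw, rfl⟩, hwr⟩ := exists_lt_of_csInf_lt hne (EReal.coe_lt_coe_iff.1 hr)
    obtain ⟨y, hy, hyz, hyr⟩ := exists_norm_sub_lt_of_convexOn (convexOn_homDensity J) hw.2 hz hρ
      (mem_closedBall_iff_norm.1 hw.1) hwr
    obtain ⟨ε, hε, hερ⟩ := exists_between (lt_min (sub_pos.2 hyz) (sub_pos.2 hyr))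
    rw [lt_min_iff] at hερ
    filter_upwards [eventually_cellInf_le (J := J) (mem_closedBall_zero_iff.1 hy) hε
        (show ‖y - z‖ + ε ≤ ρ by linarith),
      (tendsto_pred_mul_add_div _ (2 * (|J| + 1))).eventually_lt_const
        (show homDensity J y + ε < r by linarith)] with k hk hkr
    exact hk.trans_lt ((EReal.coe_lt_coe_iff.2 hkr).trans hra)

lemma isHomLimit_homDensity (J : ℝ) {z : Plane} (hz : z ∈ Metric.closedBall (0 : Plane) 1) :
    IsHomLimit J z (homDensity J z) :=
  ⟨_, fun _ hρ => tendsto_cellInf hz hρ, tendsto_sInf_image_closedBall hz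
    (lowerSemicontinuousOn_homDensity J z hz) (bddBelow_image_homDensity J)⟩

end HomogenizedDensity

/-! ### Convergence of integrals -/

section Convergence

variable {ι α E : Type*} {l : Filter ι}

lemma exists_seq_of_forall_eventually {P : ℝ → ℕ → α → Prop}
    (h : ∀ ε > 0, ∀ᶠ n in atTop, ∃ y, P ε n y) :
    ∃ (ε : ℕ → ℝ) (y : ℕ → α), Tendsto ε atTop (𝓝 0) ∧ ∀ᶠ n in atTop, P (ε n) n (y n) := by
  classical
  choose N hN using fun k : ℕ => eventually_atTop.1 (h (1 / (k + 1)) Nat.one_div_pos_of_nat)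
  let κ : ℕ → ℕ := fun n => Nat.findGreatest (fun k => N k ≤ n) n
  have hκ : Tendsto κ atTop atTop := tendsto_atTop.2 fun K => by
    filter_upwards [eventually_ge_atTop K, eventually_ge_atTop (N K)] with n hn hNn
    exact Nat.le_findGreatest hn hNn
  have hP : ∀ᶠ n in atTop, ∃ y, P (1 / (κ n + 1)) n y := by
    filter_upwards [eventually_ge_atTop (N 0)] with n hn
    exact hN _ _ (Nat.findGreatest_spec (P := fun k => N k ≤ n) (Nat.zero_le n) hn)
  obtain ⟨y, hy⟩ := hP.choice
  exact ⟨_, y, tendsto_one_div_add_atTop_nhds_zero_nat.comp hκ, hy⟩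

variable {m : MeasurableSpace α} {μ : Measure α}

lemma integral_le_of_forall_integral_le_of_nonneg {F : ℕ → α → ℝ} {f : α → ℝ} {a : ℝ}
    (hF : ∀ n, Integrable (F n) μ) (hf : Integrable f μ) (hnonneg : ∀ n, 0 ≤ᵐ[μ] F n)
    (hlim : ∀ᵐ x ∂μ, ∀ b < f x, ∀ᶠ n in atTop, b < F n x) (ha : ∀ n, ∫ x, F n x ∂μ ≤ a) :
    ∫ x, f x ∂μ ≤ a := by
  have hpoint : ∀ᵐ x ∂μ, ENNReal.ofReal (f x) ≤
      liminf (fun n => ENNReal.ofReal (F n x)) atTop := by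
    filter_upwards [hlim] with x hx
    refine le_of_forall_lt fun d hd => ?_
    obtain ⟨d', hdd', hd'⟩ := exists_between hd
    refine hdd'.trans_le (le_liminf_of_le (by isBoundedDefault) ?_)
    filter_upwards [hx d'.toReal (ENNReal.toReal_lt_of_lt_ofReal hd')] with n hn
    exact (ENNReal.ofReal_toReal hd'.ne_top).ge.trans (ENNReal.ofReal_le_ofReal hn.le)
  have hfatou : ∫⁻ x, ENNReal.ofReal (f x) ∂μ ≤ ENNReal.ofReal a :=
    calc ∫⁻ x, ENNReal.ofReal (f x) ∂μ
      _ ≤ ∫⁻ x, liminf (fun n => ENNReal.ofReal (F n x)) atTop ∂μ := lintegral_mono_ae hpoint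
      _ ≤ liminf (fun n => ∫⁻ x, ENNReal.ofReal (F n x) ∂μ) atTop :=
        lintegral_liminf_le' fun n => (hF n).aemeasurable.ennreal_ofReal
      _ ≤ ENNReal.ofReal a := by
        refine liminf_le_of_frequently_le' (Frequently.of_forall fun n => ?_)
        rw [← ofReal_integral_eq_lintegral_ofReal (hF n) (hnonneg n)]
        exact ENNReal.ofReal_le_ofReal (ha n)
  rw [integral_eq_lintegral_pos_part_sub_lintegral_neg_part hf]
  exact (sub_le_self _ ENNReal.toReal_nonneg).trans
    (ENNReal.toReal_le_of_le_ofReal ((integral_nonneg_of_ae (hnonneg 0)).trans (ha 0)) hfatou)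

lemma integral_le_of_forall_integral_le [IsFiniteMeasure μ] {F : ℕ → α → ℝ} {f : α → ℝ} {a c : ℝ}
    (hF : ∀ n, Integrable (F n) μ) (hf : Integrable f μ) (hc : ∀ n, ∀ᵐ x ∂μ, c ≤ F n x)
    (hlim : ∀ᵐ x ∂μ, ∀ b < f x, ∀ᶠ n in atTop, b < F n x) (ha : ∀ n, ∫ x, F n x ∂μ ≤ a) :
    ∫ x, f x ∂μ ≤ a := by
  have hconst := integrable_const (μ := μ) c
  refine (sub_le_sub_iff_right (∫ _, c ∂μ)).1 ((integral_sub hf hconst).ge.trans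
    (integral_le_of_forall_integral_le_of_nonneg (fun n => (hF n).sub hconst) (hf.sub hconst)
      (fun n => ?_) ?_ fun n => (integral_sub (hF n) hconst).le.trans (sub_le_sub_right (ha n) _)))
  · filter_upwards [hc n] with x hx using sub_nonneg.2 hx
  · filter_upwards [hlim] with x hx b hb
    filter_upwards [hx (b + c) (lt_sub_iff_add_lt.1 hb)] with n hn using lt_sub_iff_add_lt.2 hn

lemma integrable_comp_of_lowerSemicontinuousOn [TopologicalSpace E] [MeasurableSpace E]
    [BorelSpace E] [IsFiniteMeasure μ] {s : Set E} {f : E → ℝ} {w : α → E} {C : ℝ}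
    (hs : MeasurableSet s) (hf : LowerSemicontinuousOn f s) (hC : ∀ z ∈ s, |f z| ≤ C)
    (hw : AEMeasurable w μ) (hws : ∀ᵐ x ∂μ, w x ∈ s) : Integrable (fun x => f (w x)) μ := by
  have hmeas : AEMeasurable f (μ.map w) := by
    rw [← Measure.restrict_eq_self_of_ae_mem ((ae_map_iff hw hs).2 hws)]
    exact aemeasurable_restrict_of_measurable_subtype hs
      (lowerSemicontinuous_restrict_iff.2 hf).measurable
  refine Integrable.of_bound (hmeas.comp_aemeasurable hw).aestronglyMeasurable C ?_
  filter_upwards [hws] with x hx using hC _ hx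

section NormedSpace

variable [NormedAddCommGroup E] [NormedSpace ℝ E] [CompleteSpace E]

lemma tendsto_setIntegral_of_isPiSystem [IsFiniteMeasure μ]
    {S : Set (Set α)} (hgen : m = MeasurableSpace.generateFrom S) (hS : IsPiSystem S)
    {u : ι → α → E} {w : α → E} {C : ℝ} (hu : ∀ i, Integrable (u i) μ) (hw : Integrable w μ)
    (hC : ∀ i, ∀ᵐ x ∂μ, ‖u i x‖ ≤ C)
    (huniv : Tendsto (fun i => ∫ x, u i x ∂μ) l (𝓝 (∫ x, w x ∂μ)))
    (hlim : ∀ s ∈ S, Tendsto (fun i => ∫ x in s, u i x ∂μ) l (𝓝 (∫ x in s, w x ∂μ)))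
    {s : Set α} (hs : MeasurableSet s) :
    Tendsto (fun i => ∫ x in s, u i x ∂μ) l (𝓝 (∫ x in s, w x ∂μ)) := by
  induction s, hs using MeasurableSpace.induction_on_inter hgen hS with
  | empty => simpa only [setIntegral_empty] using tendsto_const_nhds
  | basic t ht => exact hlim t ht
  | compl t ht ih =>
    simpa only [setIntegral_compl ht (hu _), setIntegral_compl ht hw] using huniv.sub ih
  | iUnion t hd ht ih =>
    simp only [integral_iUnion ht hd (hu _).integrableOn, integral_iUnion ht hd hw.integrableOn]
    refine tendsto_tsum_of_dominated_convergence (bound := fun k => C * μ.real (t k)) ?_ ih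
      (Eventually.of_forall fun i k =>
        norm_setIntegral_le_of_norm_le_const_ae (measure_lt_top _ _) (ae_restrict_of_ae (hC i)))
    refine (ENNReal.summable_toReal ?_).mul_left C
    rw [← measure_iUnion hd ht]
    exact measure_ne_top _ _

end NormedSpace

section InnerProductSpace

variable [NormedAddCommGroup E] [InnerProductSpace ℝ E]

lemma tendsto_of_tendsto_inner [FiniteDimensional ℝ E] {u : ι → E} {z : E}
    (h : ∀ e, Tendsto (fun i => inner ℝ (u i) e) l (𝓝 (inner ℝ z e))) : Tendsto u l (𝓝 z) := by
  have hsum := tendsto_finsetSum Finset.univ fun j _ =>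
    (h (stdOrthonormalBasis ℝ E j)).smul_const (stdOrthonormalBasis ℝ E j)
  have hrepr : ∀ x : E,
      ∑ j, inner ℝ x (stdOrthonormalBasis ℝ E j) • stdOrthonormalBasis ℝ E j = x := fun x => by
    simp_rw [← real_inner_comm x]
    exact (stdOrthonormalBasis ℝ E).sum_repr' x
  simpa only [hrepr] using hsum

lemma integral_inner_indicator [CompleteSpace E] {u : α → E} (hu : Integrable u μ) {s : Set α}
    (hs : MeasurableSet s) (e : E) :
    ∫ x, inner ℝ (u x) (s.indicator (fun _ => e) x) ∂μ = inner ℝ (∫ x in s, u x ∂μ) e := by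
  have hind : (fun x => inner ℝ (u x) (s.indicator (fun _ => e) x)) =
      s.indicator fun x => inner ℝ e (u x) := by
    funext x
    by_cases hx : x ∈ s <;> simp [hx, real_inner_comm]
  rw [hind, integral_indicator hs, integral_inner hu.integrableOn, real_inner_comm]

lemma integrable_inner {v g : α → E} {C : ℝ} (hv : AEStronglyMeasurable v μ)
    (hC : ∀ᵐ x ∂μ, ‖v x‖ ≤ C) (hg : Integrable g μ) :
    Integrable (fun x => inner ℝ (v x) (g x)) μ := by
  refine (hg.norm.const_mul C).mono' (hv.inner hg.1) ?_
  filter_upwards [hC] with x hx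
  exact (norm_inner_le_norm _ _).trans (by gcongr)

lemma lipschitzWith_integral_inner {v : α → E} {C : NNReal} (hv : AEStronglyMeasurable v μ)
    (hC : ∀ᵐ x ∂μ, ‖v x‖ ≤ C) :
    LipschitzWith C fun g : α →₁[μ] E => ∫ x, inner ℝ (v x) (g x) ∂μ := by
  refine LipschitzWith.of_dist_le_mul fun f g => ?_
  have hf := L1.integrable_coeFn f
  have hg := L1.integrable_coeFn g
  rw [dist_eq_norm, dist_eq_norm, L1.norm_eq_integral_norm, ← integral_const_mul,
    ← integral_sub (integrable_inner hv hC hf) (integrable_inner hv hC hg)]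
  refine norm_integral_le_of_norm_le ((L1.integrable_coeFn _).norm.const_mul _) ?_
  filter_upwards [hC, Lp.coeFn_sub f g] with x hx hfg
  rw [hfg, Pi.sub_apply, ← inner_sub_right]
  exact (norm_inner_le_norm _ _).trans (by gcongr)

lemma tendsto_integral_inner_of_tendsto_setIntegral [CompleteSpace E] [IsFiniteMeasure μ]
    {u : ι → α → E} {w : α → E} {C : NNReal} (hu : ∀ i, Integrable (u i) μ) (hw : Integrable w μ)
    (huC : ∀ i, ∀ᵐ x ∂μ, ‖u i x‖ ≤ C) (hwC : ∀ᵐ x ∂μ, ‖w x‖ ≤ C)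
    (hlim : ∀ s, MeasurableSet s →
      Tendsto (fun i => ∫ x in s, u i x ∂μ) l (𝓝 (∫ x in s, w x ∂μ)))
    {g : α → E} (hg : Integrable g μ) :
    Tendsto (fun i => ∫ x, inner ℝ (u i x) (g x) ∂μ) l (𝓝 (∫ x, inner ℝ (w x) (g x) ∂μ)) := by
  refine Integrable.induction (fun g => Tendsto (fun i => ∫ x, inner ℝ (u i x) (g x) ∂μ) l
    (𝓝 (∫ x, inner ℝ (w x) (g x) ∂μ))) ?_ ?_ ?_ ?_ hg
  · intro c s hs _
    simpa only [integral_inner_indicator (hu _) hs, integral_inner_indicator hw hs] using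
      (hlim s hs).inner tendsto_const_nhds
  · intro f g _ hf hg hlimf hlimg
    have hadd : ∀ {v : α → E}, Integrable v μ → (∀ᵐ x ∂μ, ‖v x‖ ≤ C) →
        ∫ x, inner ℝ (v x) ((f + g) x) ∂μ =
          ∫ x, inner ℝ (v x) (f x) ∂μ + ∫ x, inner ℝ (v x) (g x) ∂μ := fun hv hvC => by
      simp only [Pi.add_apply, inner_add_right]
      exact integral_add (integrable_inner hv.1 hvC hf) (integrable_inner hv.1 hvC hg)
    simpa only [hadd (hu _) (huC _), hadd hw hwC] using hlimf.add hlimg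
  · exact (LipschitzWith.uniformEquicontinuous _ C fun i =>
      lipschitzWith_integral_inner (hu i).1 (huC i)).equicontinuous.isClosed_setOfPred_tendsto
      (lipschitzWith_integral_inner hw.1 hwC).continuous
  · intro f g hfg _ hlimf
    have hcongr : ∀ v : α → E, ∫ x, inner ℝ (v x) (f x) ∂μ = ∫ x, inner ℝ (v x) (g x) ∂μ :=
      fun v => integral_congr_ae (by filter_upwards [hfg] with x hx; rw [hx])
    simpa only [hcongr] using hlimf

end InnerProductSpace

end Convergence

/-! ### Step functions and cell averages -/

section Step

variable {E : Type*} {lam : ℝ}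

lemma step_ae_eq (hlam : 0 < lam) (g : ℕ → E) (s : ℕ) :
    ∀ᵐ x, x ∈ Set.uIoc (lam * s) (lam * (s + 1 : ℕ)) → g ⌊x / lam⌋₊ = g s := by
  filter_upwards [Measure.ae_ne volume (lam * (s + 1 : ℕ))] with x hne hx
  rw [Set.uIoc_of_le (by gcongr; simp)] at hx
  congr 1
  rw [Nat.floor_eq_iff (div_nonneg ((by positivity : 0 ≤ lam * s).trans hx.1.le) hlam.le),
    le_div_iff₀' hlam, div_lt_iff₀' hlam]
  exact ⟨hx.1.le, by exact_mod_cast lt_of_le_of_ne hx.2 hne⟩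

variable [NormedAddCommGroup E]

lemma intervalIntegrable_step_cell (hlam : 0 < lam) (g : ℕ → E) (s : ℕ) :
    IntervalIntegrable (fun x => g ⌊x / lam⌋₊) volume (lam * s) (lam * (s + 1 : ℕ)) := by
  refine (intervalIntegrable_const (c := g s)).congr_ae ?_
  rw [EventuallyEq, ae_restrict_iff' measurableSet_uIoc]
  filter_upwards [step_ae_eq hlam g s] with x hx hmem using (hx hmem).symm

lemma integral_step [NormedSpace ℝ E] [CompleteSpace E] (hlam : 0 < lam) (g : ℕ → E) (s : ℕ) :
    ∫ x in 0..lam * s, g ⌊x / lam⌋₊ = lam • ∑ j ∈ Finset.range s, g j := by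
  have hsum := intervalIntegral.sum_integral_adjacent_intervals (n := s)
    fun k _ => intervalIntegrable_step_cell hlam g k
  rw [Nat.cast_zero, mul_zero] at hsum
  rw [← hsum, Finset.smul_sum]
  refine Finset.sum_congr rfl fun j _ => ?_
  rw [intervalIntegral.integral_congr_ae (step_ae_eq hlam g j), intervalIntegral.integral_const]
  congr 1
  push_cast
  ring

end Step

section CellMean

variable {E : Type*} [NormedAddCommGroup E] {w : ℝ → E} {M j k : ℕ}

lemma natCast_div_mem_Icc (hj : j ≤ M) : (j / M : ℝ) ∈ Set.Icc (0 : ℝ) 1 :=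
  ⟨by positivity, div_le_one_of_le₀ (by exact_mod_cast hj) (by positivity)⟩

lemma natCast_div_le_succ_div (M j : ℕ) : (j / M : ℝ) ≤ (j + 1 : ℕ) / M := by
  gcongr
  exact j.le_succ

lemma volI_eq : volI = volume.restrict (Set.Ioc (0 : ℝ) 1) :=
  Measure.restrict_congr_set Ioo_ae_eq_Ioc

lemma integrable_volI_iff {f : ℝ → E} : Integrable f volI ↔ IntervalIntegrable f volume 0 1 := by
  rw [volI_eq, intervalIntegrable_iff_integrableOn_Ioc_of_le zero_le_one, IntegrableOn]

lemma ae_volI_mem : ∀ᵐ x ∂volI, x ∈ Set.Ioo (0 : ℝ) 1 := ae_restrict_mem measurableSet_Ioo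

lemma intervalIntegrable_of_mem_Icc (hw : IntervalIntegrable w volume 0 1) {a b : ℝ}
    (ha : a ∈ Set.Icc (0 : ℝ) 1) (hb : b ∈ Set.Icc (0 : ℝ) 1) :
    IntervalIntegrable w volume a b := by
  rw [← Set.uIcc_of_le zero_le_one] at ha hb
  exact hw.mono_set (Set.uIcc_subset_uIcc ha hb)

variable [NormedSpace ℝ E]

/-- The mean of `w` over the cell `[j/M, (j+1)/M]`. -/
def cellMean (w : ℝ → E) (M j : ℕ) : E := ⨍ x in Set.Ioc (j / M : ℝ) ((j + 1 : ℕ) / M), w x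

lemma inv_smul_cellMean (w : ℝ → E) (M j : ℕ) :
    (M : ℝ)⁻¹ • cellMean w M j = ∫ x in (j / M : ℝ)..(j + 1 : ℕ) / M, w x := by
  have hle := natCast_div_le_succ_div M j
  rcases eq_or_ne M 0 with rfl | hM
  · simp
  have hlen : ((j + 1 : ℕ) / M : ℝ) - j / M = (M : ℝ)⁻¹ := by push_cast; ring
  rw [cellMean, intervalIntegral.integral_of_le hle, setAverage_eq,
    Real.volume_real_Ioc_of_le hle, hlen, smul_inv_smul₀ (by positivity)]

lemma sum_inv_smul_cellMean (hw : IntervalIntegrable w volume 0 1) (hk : k ≤ M) :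
    ∑ j ∈ Finset.range k, (M : ℝ)⁻¹ • cellMean w M j = ∫ x in 0..(k / M : ℝ), w x := by
  have hsum := intervalIntegral.sum_integral_adjacent_intervals (f := w) (μ := volume)
    (a := fun j : ℕ => (j / M : ℝ)) (n := k) fun j hj => intervalIntegrable_of_mem_Icc hw
      (natCast_div_mem_Icc (hj.le.trans hk)) (natCast_div_mem_Icc (hj.trans_le hk))
  simpa only [inv_smul_cellMean, Nat.cast_zero, zero_div] using hsum

lemma integral_volI (f : ℝ → E) : ∫ x, f x ∂volI = ∫ x in 0..1, f x := by
  rw [volI_eq, intervalIntegral.integral_of_le zero_le_one]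

lemma cellMean_mem [CompleteSpace E] (hw : IntervalIntegrable w volume 0 1) {K : Set E}
    (hK : Convex ℝ K) (hKc : IsClosed K) (hwK : ∀ᵐ x ∂volI, w x ∈ K) (hj : j < M) :
    cellMean w M j ∈ K := by
  have hM : (0 : ℝ) < M := by exact_mod_cast j.zero_le.trans_lt hj
  have hlt : (j / M : ℝ) < (j + 1 : ℕ) / M := by gcongr; exact j.lt_succ_self
  have hj₀ := natCast_div_mem_Icc hj.le
  have hj₁ := natCast_div_mem_Icc (Nat.succ_le_of_lt hj)
  refine hK.set_average_mem hKc ?_ measure_Ioc_lt_top.ne ?_ ?_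
  · simpa only [Real.volume_Ioc, ne_eq, ENNReal.ofReal_eq_zero, not_le, sub_pos] using hlt
  · rw [volI_eq] at hwK
    exact ae_mono (Measure.restrict_mono (Set.Ioc_subset_Ioc hj₀.1 hj₁.2) le_rfl) hwK
  · rw [← intervalIntegrable_iff_integrableOn_Ioc_of_le hlt.le]
    exact intervalIntegrable_of_mem_Icc hw hj₀ hj₁

lemma closedBall_eq_Icc_cell (M j : ℕ) :
    Metric.closedBall ((j + 1 / 2) / M : ℝ) (1 / 2 / M) =
      Set.Icc (j / M : ℝ) ((j + 1 : ℕ) / M) := by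
  rw [Real.closedBall_eq_Icc, ← sub_div, ← add_div]
  congr 2 <;> · push_cast; ring

lemma floor_mul_div_mem_cell (hM : 0 < M) {x : ℝ} (hx : 0 ≤ x) :
    x ∈ Set.Icc (⌊x * M⌋₊ / M : ℝ) ((⌊x * M⌋₊ + 1 : ℕ) / M) := by
  have hM' : (0 : ℝ) < M := by exact_mod_cast hM
  rw [Set.mem_Icc, div_le_iff₀ hM', le_div_iff₀ hM', Nat.cast_add_one]
  exact ⟨Nat.floor_le (by positivity), (Nat.lt_floor_add_one _).le⟩

lemma ae_tendsto_cellMean [CompleteSpace E] (hw : LocallyIntegrable w volume) :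
    ∀ᵐ x : ℝ, 0 ≤ x → Tendsto (fun M : ℕ => cellMean w M ⌊x * M⌋₊) atTop (𝓝 (w x)) := by
  filter_upwards [IsUnifLocDoublingMeasure.ae_tendsto_average (μ := volume) hw 1] with x hx hx₀
  refine (hx (fun M : ℕ => (⌊x * M⌋₊ + 1 / 2) / M) (fun M : ℕ => 1 / 2 / M) ?_ ?_).congr
    fun M => ?_
  · refine tendsto_nhdsWithin_iff.2 ⟨tendsto_const_div_atTop_nhds_zero_nat _, ?_⟩
    filter_upwards [eventually_gt_atTop 0] with M hM
    rw [Set.mem_Ioi]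
    positivity
  · filter_upwards [eventually_gt_atTop 0] with M hM
    rw [one_mul, closedBall_eq_Icc_cell]
    exact floor_mul_div_mem_cell hM hx₀
  · rw [closedBall_eq_Icc_cell, setAverage_congr Ioc_ae_eq_Icc.symm, cellMean]

lemma floor_mul_lt_of_mem_Ioo (hM : 0 < M) {x : ℝ} (hx : x ∈ Set.Ioo (0 : ℝ) 1) :
    ⌊x * M⌋₊ < M := by
  have hM' : (0 : ℝ) < M := by exact_mod_cast hM
  rw [Nat.floor_lt (mul_nonneg hx.1.le hM'.le)]
  exact mul_lt_of_lt_one_left hM' hx.2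

lemma cellMean_congr {w' : ℝ → E} (h : Set.EqOn w w' (Set.Ioc 0 1)) (hj : j < M) :
    cellMean w M j = cellMean w' M j :=
  setAverage_congr_fun measurableSet_Ioc <| ae_of_all _ fun _ hy =>
    h ⟨(natCast_div_mem_Icc hj.le).1.trans_lt hy.1,
      hy.2.trans (natCast_div_mem_Icc (Nat.succ_le_of_lt hj)).2⟩

lemma ae_volI_tendsto_cellMean [CompleteSpace E] (hw : IntervalIntegrable w volume 0 1) :
    ∀ᵐ x : ℝ ∂volI, Tendsto (fun M : ℕ => cellMean w M ⌊x * M⌋₊) atTop (𝓝 (w x)) := by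
  rw [intervalIntegrable_iff_integrableOn_Ioc_of_le zero_le_one] at hw
  have hlim := ae_tendsto_cellMean (hw.integrable_indicator measurableSet_Ioc).locallyIntegrable
  have heq : Set.EqOn ((Set.Ioc 0 1).indicator w) w (Set.Ioc 0 1) := Set.eqOn_indicator
  filter_upwards [ae_restrict_of_ae hlim, ae_volI_mem] with x hx hx01
  rw [← heq ⟨hx01.1, hx01.2.le⟩]
  refine (hx hx01.1.le).congr' ?_
  filter_upwards [eventually_gt_atTop 0] with M hM
  exact cellMean_congr heq (floor_mul_lt_of_mem_Ioo hM hx01)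

lemma integral_le_of_sum_cellMean_le [CompleteSpace E] [MeasurableSpace E] [BorelSpace E]
    {f : E → ℝ} {s : Set E} {C a : ℝ} (hs : IsClosed s) (hf : LowerSemicontinuousOn f s)
    (hC : ∀ z ∈ s, |f z| ≤ C) (hw : IntervalIntegrable w volume 0 1)
    (hmem : ∀ M, ∀ j < M, cellMean w M j ∈ s)
    (hsum : ∀ M > 0, ∑ j ∈ Finset.range M, (M : ℝ)⁻¹ * f (cellMean w M j) ≤ a) :
    (∀ᵐ x ∂volI, w x ∈ s) ∧ ∫ x, f (w x) ∂volI ≤ a := by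
  let c : ℕ → ℝ → E := fun M x => cellMean w (M + 1) ⌊x * (M + 1 : ℕ)⌋₊
  have hc : ∀ M, ∀ᵐ x ∂volI, c M x ∈ s := fun M => by
    filter_upwards [ae_volI_mem] with x hx
    exact hmem _ _ (floor_mul_lt_of_mem_Ioo M.succ_pos hx)
  have hlim : ∀ᵐ x ∂volI, Tendsto (fun M => c M x) atTop (𝓝[s] w x) := by
    filter_upwards [ae_volI_tendsto_cellMean hw, ae_all_iff.2 hc] with x hx hcx
    exact tendsto_nhdsWithin_iff.2 ⟨hx.comp (tendsto_add_atTop_nat 1), Eventually.of_forall hcx⟩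
  have hws : ∀ᵐ x ∂volI, w x ∈ s := by
    filter_upwards [hlim, ae_all_iff.2 hc] with x hx hcx
    exact hs.mem_of_tendsto (tendsto_nhds_of_tendsto_nhdsWithin hx) (Eventually.of_forall hcx)
  have hcmeas : ∀ M, Measurable (c M) := fun M =>
    (measurable_from_nat (f := cellMean w (M + 1))).comp
      (Nat.measurable_floor.comp (measurable_id.mul_const _))
  have hint : ∀ {g : ℝ → E}, AEMeasurable g volI → (∀ᵐ x ∂volI, g x ∈ s) →
      Integrable (fun x => f (g x)) volI :=
    integrable_comp_of_lowerSemicontinuousOn hs.measurableSet hf hC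
  refine ⟨hws, integral_le_of_forall_integral_le (c := -C)
    (fun M => hint (hcmeas M).aemeasurable (hc M))
    (hint (integrable_volI_iff.2 hw).aemeasurable hws) (fun M => ?_) ?_ fun M => ?_⟩
  · filter_upwards [hc M] with x hx using neg_le_of_abs_le (hC _ hx)
  · filter_upwards [hlim, hws] with x hx hwx b hb using hx.eventually (hf _ hwx b hb)
  · have hM : (0 : ℝ) < (M + 1 : ℕ) := by positivity
    have hstep := integral_step (inv_pos.2 hM) (fun j => f (cellMean w (M + 1) j)) (M + 1)
    rw [inv_mul_cancel₀ hM.ne', smul_eq_mul, Finset.mul_sum] at hstep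
    simp_rw [div_inv_eq_mul] at hstep
    rw [integral_volI, hstep]
    exact hsum _ M.succ_pos

end CellMean

/-! ### Weak-* convergence and primitives -/

section Primitive

variable {E : Type*} [NormedAddCommGroup E] [NormedSpace ℝ E]

lemma setIntegral_Iic_volI (f : ℝ → E) (x : ℝ) :
    ∫ y in Set.Iic x, f y ∂volI = ∫ y in 0..(Set.projIcc (0 : ℝ) 1 zero_le_one x : ℝ), f y := by
  rw [volI_eq, Measure.restrict_restrict measurableSet_Iic, Set.inter_comm, Set.Ioc_inter_Iic,
    intervalIntegral.integral_of_le (Set.projIcc (0 : ℝ) 1 zero_le_one x).2.1, Set.coe_projIcc]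
  congr 2
  ext y
  simp only [Set.mem_Ioc, le_max_iff]
  exact and_congr_right fun hy => (or_iff_right hy.not_ge).symm

lemma norm_integral_sub_integral_le {f : ℝ → E} {a b : ℝ} (hf : IntervalIntegrable f volume 0 1)
    (hf₁ : ∀ᵐ x ∂volI, ‖f x‖ ≤ 1) (ha : a ∈ Set.Icc (0 : ℝ) 1) (hb : b ∈ Set.Icc (0 : ℝ) 1) :
    ‖(∫ x in 0..b, f x) - ∫ x in 0..a, f x‖ ≤ |b - a| := by
  have h0 : (0 : ℝ) ∈ Set.Icc (0 : ℝ) 1 := Set.left_mem_Icc.2 zero_le_one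
  rw [intervalIntegral.integral_interval_sub_left (intervalIntegrable_of_mem_Icc hf h0 hb)
    (intervalIntegrable_of_mem_Icc hf h0 ha), ← one_mul |b - a|]
  rw [volI_eq, ae_restrict_iff' measurableSet_Ioc] at hf₁
  refine intervalIntegral.norm_integral_le_of_norm_le_const_ae ?_
  filter_upwards [hf₁] with x hx hmem
  exact hx ⟨(le_min ha.1 hb.1).trans_lt hmem.1, hmem.2.trans (max_le ha.2 hb.2)⟩

lemma norm_integral_sub_le_of_nodes {f g : ℝ → E} {M : ℕ} {δ : ℝ} (hM : 0 < M)
    (hf : IntervalIntegrable f volume 0 1) (hf₁ : ∀ᵐ x ∂volI, ‖f x‖ ≤ 1)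
    (hg : IntervalIntegrable g volume 0 1) (hg₁ : ∀ᵐ x ∂volI, ‖g x‖ ≤ 1)
    (h : ∀ k ≤ M, ‖(∫ x in 0..(k / M : ℝ), f x) - ∫ x in 0..(k / M : ℝ), g x‖ ≤ δ) {x : ℝ}
    (hx : x ∈ Set.Icc (0 : ℝ) 1) :
    ‖(∫ y in 0..x, f y) - ∫ y in 0..x, g y‖ ≤ δ + 2 / M := by
  have hM' : (0 : ℝ) < M := by exact_mod_cast hM
  have hk : ⌊x * M⌋₊ ≤ M := by
    rw [← Nat.floor_natCast (R := ℝ) M]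
    exact Nat.floor_le_floor (by simpa using mul_le_of_le_one_left hM'.le hx.2)
  have hnode := natCast_div_mem_Icc hk
  have hdist : |x - ⌊x * M⌋₊ / M| ≤ 1 / M := by
    obtain ⟨hl, hr⟩ := floor_mul_div_mem_cell hM hx.1
    rw [abs_of_nonneg (sub_nonneg.2 hl), sub_le_iff_le_add', ← add_div]
    exact_mod_cast hr
  have hfx := (norm_integral_sub_integral_le hf hf₁ hnode hx).trans hdist
  have hgx := (norm_integral_sub_integral_le hg hg₁ hnode hx).trans hdist
  rw [norm_sub_rev] at hgx
  calc ‖(∫ y in 0..x, f y) - ∫ y in 0..x, g y‖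
    _ = ‖((∫ y in 0..x, f y) - ∫ y in 0..(⌊x * M⌋₊ / M : ℝ), f y) +
          ((∫ y in 0..(⌊x * M⌋₊ / M : ℝ), f y) - ∫ y in 0..(⌊x * M⌋₊ / M : ℝ), g y) +
          ((∫ y in 0..(⌊x * M⌋₊ / M : ℝ), g y) - ∫ y in 0..x, g y)‖ := by congr 1; abel
    _ ≤ 1 / M + δ + 1 / M := norm_add₃_le.trans (by gcongr; exact h _ hk)
    _ = δ + 2 / M := by ring

lemma integrable_of_LInfI (u : LInfI) : Integrable u volI := (Lp.memLp u).integrable le_top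

lemma WeakStarTendsto.tendsto_integral {u : ℕ → LInfI} {w : LInfI} (h : WeakStarTendsto u w)
    {x : ℝ} (hx : x ∈ Set.Icc (0 : ℝ) 1) :
    Tendsto (fun n => ∫ y in 0..x, u n y) atTop (𝓝 (∫ y in 0..x, w y)) := by
  refine tendsto_of_tendsto_inner fun e => ?_
  have hind := h ((Set.Iic x).indicator fun _ => e)
    ((integrable_const e).indicator measurableSet_Iic)
  simpa only [integral_inner_indicator (integrable_of_LInfI _) measurableSet_Iic,
    setIntegral_Iic_volI, Set.projIcc_of_mem _ hx] using hind

lemma weakStarTendsto_of_tendsto_integral {u : ℕ → LInfI} {w : LInfI}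
    (hu : ∀ n, ∀ᵐ x ∂volI, ‖u n x‖ ≤ 1) (hw : ∀ᵐ x ∂volI, ‖w x‖ ≤ 1)
    (h : ∀ x ∈ Set.Icc (0 : ℝ) 1,
      Tendsto (fun n => ∫ y in 0..x, u n y) atTop (𝓝 (∫ y in 0..x, w y))) :
    WeakStarTendsto u w := fun g hg => by
  refine tendsto_integral_inner_of_tendsto_setIntegral (C := 1)
    (fun n => integrable_of_LInfI (u n)) (integrable_of_LInfI w) hu hw (fun s hs => ?_) hg
  refine tendsto_setIntegral_of_isPiSystem (borel_eq_generateFrom_Iic ℝ) isPiSystem_Iic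
    (fun n => integrable_of_LInfI (u n)) (integrable_of_LInfI w) hu ?_ ?_ hs
  · simpa only [integral_volI] using h 1 (Set.right_mem_Icc.2 zero_le_one)
  · rintro _ ⟨x, rfl⟩
    simpa only [setIntegral_Iic_volI] using h _ (Set.projIcc (0 : ℝ) 1 zero_le_one x).2

lemma intervalIntegral_congr_volI {f g : ℝ → E} (h : f =ᵐ[volI] g) {x : ℝ}
    (hx : x ∈ Set.Icc (0 : ℝ) 1) : ∫ y in 0..x, f y = ∫ y in 0..x, g y := by
  rw [volI_eq] at h
  refine intervalIntegral.integral_congr_ae_restrict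
    (ae_mono (Measure.restrict_mono ?_ le_rfl) h)
  rw [Set.uIoc_of_le hx.1]
  exact Set.Ioc_subset_Ioc_right hx.2

lemma measurable_interp (lam : ℝ) (v : Spins) : Measurable (interp lam v) :=
  (measurable_from_nat (f := fun n => (v n : Plane))).comp
    (Nat.measurable_floor.comp (measurable_id.div_const lam))

lemma norm_interp (lam : ℝ) (v : Spins) (x : ℝ) : ‖interp lam v x‖ = 1 := norm_spin _

lemma intervalIntegrable_interp (lam : ℝ) (v : Spins) (a b : ℝ) :
    IntervalIntegrable (interp lam v) volume a b :=
  (intervalIntegrable_const (c := (1 : ℝ))).mono_fun (measurable_interp lam v).aestronglyMeasurable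
    (ae_of_all _ fun x => ((norm_interp lam v x).trans norm_one.symm).le)

lemma norm_integral_interp_sub_le {lam : ℝ} (hlam : 0 < lam) (v : Spins) {x : ℝ} (hx : 0 ≤ x) :
    ‖(∫ y in 0..x, interp lam v y) - lam • spinSum ⌊x / lam⌋₊ v‖ ≤ lam := by
  have hstep : ∫ y in 0..lam * ⌊x / lam⌋₊, interp lam v y = lam • spinSum ⌊x / lam⌋₊ v :=
    integral_step hlam (fun n => (v n : Plane)) _
  have hfloor := Nat.floor_le (div_nonneg hx hlam.le)
  have hlt := Nat.lt_floor_add_one (x / lam)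
  rw [le_div_iff₀ hlam] at hfloor
  rw [div_lt_iff₀ hlam] at hlt
  rw [← hstep, intervalIntegral.integral_interval_sub_left (intervalIntegrable_interp _ _ _ _)
    (intervalIntegrable_interp _ _ _ _)]
  calc ‖∫ y in lam * ⌊x / lam⌋₊..x, interp lam v y‖
    _ ≤ 1 * |x - lam * ⌊x / lam⌋₊| := intervalIntegral.norm_integral_le_of_norm_le_const
      fun y _ => (norm_interp lam v y).le
    _ ≤ lam := by rw [one_mul, abs_of_nonneg] <;> linarith

end Primitive

/-! ### The liminf inequality -/

/-- The lattice index `[(j/M)/λ]`, at which the `j`-th of `M` equal parts of the interval begins. -/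
def node (M : ℕ) (lam : ℝ) (j : ℕ) : ℕ := ⌊(j / M : ℝ) / lam⌋₊

/-- The number of lattice indices in the `j`-th of `M` equal parts of the interval. -/
def nodeLen (M : ℕ) (lam : ℝ) (j : ℕ) : ℕ := node M lam (j + 1) - node M lam j

section Node

variable {M : ℕ}

lemma node_zero (M : ℕ) (lam : ℝ) : node M lam 0 = 0 := by simp [node]

lemma node_self (hM : 0 < M) (lam : ℝ) : node M lam M = ⌊1 / lam⌋₊ := by
  rw [node, div_self (by positivity)]

lemma node_mono (M : ℕ) {lam : ℝ} (hlam : 0 < lam) : Monotone (node M lam) := fun i j hij => by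
  unfold node
  gcongr

lemma node_add_nodeLen (M : ℕ) {lam : ℝ} (hlam : 0 < lam) (j : ℕ) :
    node M lam j + nodeLen M lam j = node M lam (j + 1) :=
  Nat.add_sub_of_le (node_mono M hlam j.le_succ)

variable {lam : ℕ → ℝ}

lemma tendsto_mul_floor_div (hpos : ∀ n, 0 < lam n) (hlam : Tendsto lam atTop (𝓝 0)) {x : ℝ}
    (hx : 0 ≤ x) : Tendsto (fun n => lam n * ⌊x / lam n⌋₊) atTop (𝓝 x) := by
  have hinv : Tendsto (fun n => (lam n)⁻¹) atTop atTop :=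
    tendsto_inv_nhdsGT_zero.comp (tendsto_nhdsWithin_iff.2 ⟨hlam, Eventually.of_forall hpos⟩)
  refine ((tendsto_nat_floor_mul_div_atTop hx).comp hinv).congr fun n => ?_
  rw [Function.comp_apply, ← div_eq_mul_inv, div_inv_eq_mul, mul_comm]

lemma tendsto_mul_nodeLen (M j : ℕ) (hpos : ∀ n, 0 < lam n) (hlam : Tendsto lam atTop (𝓝 0)) :
    Tendsto (fun n => lam n * nodeLen M (lam n) j) atTop (𝓝 (M : ℝ)⁻¹) := by
  have hnode : ∀ k : ℕ, Tendsto (fun n => lam n * node M (lam n) k) atTop (𝓝 (k / M)) :=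
    fun k => tendsto_mul_floor_div hpos hlam (by positivity)
  have hlen : ((j + 1 : ℕ) / M : ℝ) - j / M = (M : ℝ)⁻¹ := by push_cast; ring
  rw [← hlen]
  refine ((hnode (j + 1)).sub (hnode j)).congr fun n => ?_
  rw [← node_add_nodeLen M (hpos n) j]
  push_cast
  ring

end Node

lemma abs_chainEnergy_sub_partialEnergy_le (J : ℝ) (N : ℕ) (v : Spins) :
    |chainEnergy J N v - partialEnergy J N v| ≤ |J| + 1 := by
  rw [chainEnergy_eq_partialEnergy]
  cases N with
  | zero => rw [sub_self, abs_zero]; positivity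
  | succ N =>
    rw [partialEnergy_succ, Nat.add_sub_cancel, sub_add_cancel_left, abs_neg]
    exact abs_bondEnergy_le J v N

lemma sum_homDensity_le_partialEnergy (J : ℝ) {s m : ℕ → ℕ} (hs₀ : s 0 = 0)
    (hs : ∀ j, s j + m j = s (j + 1)) (v : Spins) (M : ℕ) :
    ∑ j ∈ Finset.range M, m j * homDensity J (meanSpin (m j) (shift (s j) v)) ≤
      partialEnergy J (s M) v + M * interfaceCost J := by
  induction M with
  | zero => simp [hs₀, partialEnergy_zero]
  | succ M ih =>
    rw [Finset.sum_range_succ, ← hs, partialEnergy_add, Nat.cast_succ, add_one_mul]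
    linarith [homDensity_meanSpin_le J (m M) (shift (s M) v)]

lemma sum_nodeLen_mul_le_chainEnergy {J lam : ℝ} {M : ℕ} (hM : 0 < M) (hlam : 0 < lam) {v : Spins}
    {c : ℕ → ℝ}
    (hc : ∀ j < M, c j ≤ homDensity J (meanSpin (nodeLen M lam j) (shift (node M lam j) v))) :
    ∑ j ∈ Finset.range M, nodeLen M lam j * c j ≤
      chainEnergy J ⌊1 / lam⌋₊ v + (M * interfaceCost J + (|J| + 1)) := by
  have hchain := (abs_le.1 (abs_chainEnergy_sub_partialEnergy_le J ⌊1 / lam⌋₊ v)).1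
  calc ∑ j ∈ Finset.range M, nodeLen M lam j * c j
    _ ≤ ∑ j ∈ Finset.range M, nodeLen M lam j *
          homDensity J (meanSpin (nodeLen M lam j) (shift (node M lam j) v)) := by
      gcongr with j hj
      exact hc j (Finset.mem_range.1 hj)
    _ ≤ partialEnergy J (node M lam M) v + M * interfaceCost J :=
      sum_homDensity_le_partialEnergy J (node_zero M lam) (node_add_nodeLen M hlam) v M
    _ ≤ chainEnergy J ⌊1 / lam⌋₊ v + (M * interfaceCost J + (|J| + 1)) := by
      rw [node_self hM]
      linarith

section Liminf

variable {lam : ℕ → ℝ} {v : ℕ → Spins} {w : ℝ → Plane} {M j : ℕ}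

lemma tendsto_smul_spinSum (hpos : ∀ n, 0 < lam n) (hlam : Tendsto lam atTop (𝓝 0)) {x : ℝ}
    (hx : 0 ≤ x) {z : Plane}
    (h : Tendsto (fun n => ∫ y in 0..x, interp (lam n) (v n) y) atTop (𝓝 z)) :
    Tendsto (fun n => lam n • spinSum ⌊x / lam n⌋₊ (v n)) atTop (𝓝 z) := by
  have herror := squeeze_zero_norm (fun n => norm_integral_interp_sub_le (hpos n) (v n) hx) hlam
  simpa only [sub_sub_cancel, sub_zero] using h.sub herror

lemma tendsto_meanSpin_block (hpos : ∀ n, 0 < lam n) (hlam : Tendsto lam atTop (𝓝 0))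
    (hw : IntervalIntegrable w volume 0 1)
    (hconv : ∀ x ∈ Set.Icc (0 : ℝ) 1,
      Tendsto (fun n => ∫ y in 0..x, interp (lam n) (v n) y) atTop (𝓝 (∫ y in 0..x, w y)))
    (hj : j < M) :
    Tendsto (fun n => meanSpin (nodeLen M (lam n) j) (shift (node M (lam n) j) (v n))) atTop
      (𝓝 (cellMean w M j)) := by
  have hM : (M : ℝ) ≠ 0 := by exact_mod_cast (j.zero_le.trans_lt hj).ne'
  have h₀ := natCast_div_mem_Icc hj.le
  have h₁ := natCast_div_mem_Icc (Nat.succ_le_of_lt hj)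
  have hzero : (0 : ℝ) ∈ Set.Icc (0 : ℝ) 1 := Set.left_mem_Icc.2 zero_le_one
  have hsum := (tendsto_smul_spinSum hpos hlam h₁.1 (hconv _ h₁)).sub
    (tendsto_smul_spinSum hpos hlam h₀.1 (hconv _ h₀))
  rw [intervalIntegral.integral_interval_sub_left (intervalIntegrable_of_mem_Icc hw hzero h₁)
    (intervalIntegrable_of_mem_Icc hw hzero h₀), ← inv_smul_cellMean] at hsum
  have hmean := ((tendsto_mul_nodeLen M j hpos hlam).inv₀ (inv_ne_zero hM)).smul hsum
  rw [inv_inv, smul_inv_smul₀ hM] at hmean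
  refine hmean.congr fun n => ?_
  change _ • (lam n • spinSum (node M (lam n) (j + 1)) (v n) -
    lam n • spinSum (node M (lam n) j) (v n)) = _
  rw [← node_add_nodeLen M (hpos n) j, spinSum_add, smul_add, add_sub_cancel_left, mul_inv_rev,
    smul_smul, mul_assoc, inv_mul_cancel₀ (hpos n).ne', mul_one, meanSpin]

lemma sum_homDensity_cellMean_le {J : ℝ} (hpos : ∀ n, 0 < lam n) (hlam : Tendsto lam atTop (𝓝 0))
    (hM : 0 < M) {A : ℕ → Plane} (hA : ∀ j < M, ‖A j‖ ≤ 1)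
    (hlim : ∀ j < M, Tendsto (fun n => meanSpin (nodeLen M (lam n) j)
      (shift (node M (lam n) j) (v n))) atTop (𝓝 (A j)))
    {a : ℝ} (ha : ∀ n, lam n * chainEnergy J ⌊1 / lam n⌋₊ (v n) ≤ a) :
    ∑ j ∈ Finset.range M, (M : ℝ)⁻¹ * homDensity J (A j) ≤ a := by
  refine le_of_forall_pos_le_add fun ε hε => ?_
  have hlower : ∀ᶠ n in atTop, ∀ j ∈ Finset.range M, homDensity J (A j) - ε <
      homDensity J (meanSpin (nodeLen M (lam n) j) (shift (node M (lam n) j) (v n))) := by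
    refine (Filter.eventually_all_finset _).2 fun j hj => ?_
    have hj := Finset.mem_range.1 hj
    refine (tendsto_nhdsWithin_iff.2 ⟨hlim j hj, Eventually.of_forall fun n => ?_⟩).eventually
      (lowerSemicontinuousOn_homDensity J _ (mem_closedBall_zero_iff.2 (hA j hj)) _
        (sub_lt_self _ hε))
    exact mem_closedBall_zero_iff.2 (norm_meanSpin_le _ _)
  have hleft := tendsto_finsetSum (Finset.range M) fun j _ =>
    (tendsto_mul_nodeLen M j hpos hlam).mul_const (homDensity J (A j) - ε)
  have hright := (hlam.mul_const (M * interfaceCost J + (|J| + 1))).const_add a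
  have hle : ∑ j ∈ Finset.range M, (M : ℝ)⁻¹ * (homDensity J (A j) - ε) ≤
      a + 0 * (M * interfaceCost J + (|J| + 1)) := by
    refine le_of_tendsto_of_tendsto hleft hright ?_
    filter_upwards [hlower] with n hn
    have hlam₀ := (hpos n).le
    calc ∑ j ∈ Finset.range M, lam n * nodeLen M (lam n) j * (homDensity J (A j) - ε)
      _ = lam n * ∑ j ∈ Finset.range M, nodeLen M (lam n) j * (homDensity J (A j) - ε) := by
        simp only [mul_assoc, Finset.mul_sum]
      _ ≤ lam n * (chainEnergy J ⌊1 / lam n⌋₊ (v n) + (M * interfaceCost J + (|J| + 1))) := by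
        gcongr
        exact sum_nodeLen_mul_le_chainEnergy hM (hpos n)
          fun j hj => (hn j (Finset.mem_range.2 hj)).le
      _ ≤ a + lam n * (M * interfaceCost J + (|J| + 1)) := by
        rw [mul_add]
        gcongr
        exact ha n
  have hM' : (M : ℝ) ≠ 0 := by positivity
  simp only [mul_sub, Finset.sum_sub_distrib, Finset.sum_const, Finset.card_range, nsmul_eq_mul,
    mul_inv_cancel_left₀ hM', zero_mul, add_zero] at hle
  linarith

lemma integral_homDensity_le_of_energy_le {J : ℝ} (hpos : ∀ n, 0 < lam n)
    (hlam : Tendsto lam atTop (𝓝 0)) (hw : IntervalIntegrable w volume 0 1)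
    (hconv : ∀ x ∈ Set.Icc (0 : ℝ) 1,
      Tendsto (fun n => ∫ y in 0..x, interp (lam n) (v n) y) atTop (𝓝 (∫ y in 0..x, w y)))
    {a : ℝ} (ha : ∀ n, lam n * chainEnergy J ⌊1 / lam n⌋₊ (v n) ≤ a) :
    (∀ᵐ x ∂volI, w x ∈ Metric.closedBall (0 : Plane) 1) ∧
      ∫ x, homDensity J (w x) ∂volI ≤ a := by
  have hmean : ∀ M, ∀ j < M, ‖cellMean w M j‖ ≤ 1 := fun M j hj =>
    le_of_tendsto (tendsto_meanSpin_block hpos hlam hw hconv hj).norm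
      (Eventually.of_forall fun n => norm_meanSpin_le _ _)
  exact integral_le_of_sum_cellMean_le Metric.isClosed_closedBall
    (lowerSemicontinuousOn_homDensity J)
    (fun z hz => abs_homDensity_le J (mem_closedBall_zero_iff.1 hz)) hw
    (fun M j hj => mem_closedBall_zero_iff.2 (hmean M j hj))
    fun M hM => sum_homDensity_cellMean_le hpos hlam hM (hmean M)
      (fun j hj => tendsto_meanSpin_block hpos hlam hw hconv hj) ha

lemma bulkEnergy_le_liminf_energy (J : ℝ) (hpos : ∀ n, 0 < lam n) (hlam : Tendsto lam atTop (𝓝 0))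
    {w : LInfI} {u : ℕ → LInfI} (hu : WeakStarTendsto u w) :
    bulkEnergy (homDensity J) w ≤ liminf (fun n => energy J (lam n) (u n)) atTop := by
  by_contra! hlt
  obtain ⟨a, hliminf, hbulk⟩ := EReal.lt_iff_exists_real_btwn.1 hlt
  obtain ⟨φ, hφ, henergy⟩ := extraction_of_frequently_atTop
    (frequently_lt_of_liminf_lt (by isBoundedDefault) hliminf)
  simp only [energy, iInf_lt_iff, EReal.coe_lt_coe_iff] at henergy
  choose v _ hv hva using henergy
  obtain ⟨hw, hle⟩ := integral_homDensity_le_of_energy_le (lam := lam ∘ φ)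
    (fun n => hpos _) (hlam.comp hφ.tendsto_atTop) (v := v)
    (integrable_volI_iff.1 (integrable_of_LInfI w))
    (fun x hx => ((hu.tendsto_integral hx).comp hφ.tendsto_atTop).congr fun n =>
      intervalIntegral_congr_volI (hv n) hx) (fun n => (hva n).le)
  simp only [mem_closedBall_zero_iff] at hw
  rw [bulkEnergy, if_pos hw, EReal.coe_lt_coe_iff] at hbulk
  exact hbulk.not_ge hle

end Liminf

/-! ### Recovery sequences -/

lemma exists_blocks_tendsto {J : ℝ} {z : Plane} {t : ℝ} (h : (z, t) ∈ homEpigraph J) :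
    ∃ (b : ℕ → Spins) (e : ℕ → ℝ), Tendsto (fun n => meanSpin n (b n)) atTop (𝓝 z) ∧
      Tendsto e atTop (𝓝 t) ∧
      ∀ᶠ n : ℕ in atTop, partialEnergy J n (b n) + interfaceCost J ≤ n * e n := by
  obtain ⟨ε, b, hε, hb⟩ := exists_seq_of_forall_eventually
    (fun ε hε => eventually_exists_block h (ε := ε) hε)
  refine ⟨b, fun n => t + ε n, ?_, by simpa only [add_zero] using hε.const_add t,
    hb.mono fun n hn => hn.2⟩
  refine tendsto_iff_norm_sub_tendsto_zero.2 (squeeze_zero' (Eventually.of_forall fun n =>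
    norm_nonneg _) ?_ hε)
  filter_upwards [hb, eventually_gt_atTop 0] with n hn hn₀
  rw [← natCast_smul_meanSpin, ← smul_sub, norm_smul, Real.norm_natCast, mul_comm] at hn
  exact le_of_mul_le_mul_right hn.1 (Nat.cast_pos.2 hn₀)

lemma exists_concat (J : ℝ) {s m : ℕ → ℕ} (hs₀ : s 0 = 0) (hs : ∀ j, s j + m j = s (j + 1))
    (b : ℕ → Spins) (M : ℕ) :
    ∃ v : Spins, (∀ k ≤ M, spinSum (s k) v = ∑ j ∈ Finset.range k, spinSum (m j) (b j)) ∧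
      partialEnergy J (s M) v ≤
        ∑ j ∈ Finset.range M, (partialEnergy J (m j) (b j) + interfaceCost J) := by
  have hmono : Monotone s := monotone_nat_of_le_succ fun j => (hs j).symm ▸ Nat.le_add_right _ _
  induction M with
  | zero =>
    refine ⟨b 0, fun k hk => ?_, by simp [hs₀, partialEnergy_zero]⟩
    rw [Nat.le_zero.1 hk, hs₀, spinSum_zero, Finset.sum_range_zero]
  | succ M ih =>
    obtain ⟨v, hsum, henergy⟩ := ih
    refine ⟨concat (s M) v (b M), fun k hk => ?_, ?_⟩
    · rcases Nat.of_le_succ hk with hk | rfl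
      · rw [← hsum k hk]
        exact spinSum_congr fun i hi => concat_of_lt _ _ (hi.trans_le (hmono hk))
      · rw [← hs, spinSum_concat, hsum M le_rfl, Finset.sum_range_succ]
    · rw [← hs, Finset.sum_range_succ]
      linarith [partialEnergy_concat_le J (s M) (m M) v (b M)]

section Recovery

variable {J : ℝ} {lam : ℕ → ℝ} {M : ℕ} {A : ℕ → Plane} {t : ℕ → ℝ}

lemma tendsto_nodeLen_atTop (hM : 0 < M) (j : ℕ) (hpos : ∀ n, 0 < lam n)
    (hlam : Tendsto lam atTop (𝓝 0)) :
    Tendsto (fun n => nodeLen M (lam n) j) atTop atTop := by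
  have hinv : Tendsto (fun n => (lam n)⁻¹) atTop atTop :=
    tendsto_inv_nhdsGT_zero.comp (tendsto_nhdsWithin_iff.2 ⟨hlam, Eventually.of_forall hpos⟩)
  refine tendsto_natCast_atTop_iff.1 ((hinv.atTop_mul_pos (by positivity)
    (tendsto_mul_nodeLen M j hpos hlam)).congr fun n => ?_)
  exact inv_mul_cancel_left₀ (hpos n).ne' _

lemma exists_config_tendsto (hpos : ∀ n, 0 < lam n) (hlam : Tendsto lam atTop (𝓝 0))
    (hA : ∀ j < M, (A j, t j) ∈ homEpigraph J) :
    ∃ (v : ℕ → Spins) (e : ℕ → ℝ),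
      (∀ k ≤ M, Tendsto (fun n => lam n • spinSum (node M (lam n) k) (v n)) atTop
        (𝓝 (∑ j ∈ Finset.range k, (M : ℝ)⁻¹ • A j))) ∧
      Tendsto e atTop (𝓝 (∑ j ∈ Finset.range M, (M : ℝ)⁻¹ * t j)) ∧
      ∀ᶠ n in atTop, lam n * partialEnergy J (node M (lam n) M) (v n) ≤ e n := by
  have : Nonempty Spins := ⟨helix 0⟩
  choose! b e hb he hbe using fun j hj => exists_blocks_tendsto (hA j hj)
  have hlen : ∀ j < M, Tendsto (fun n => nodeLen M (lam n) j) atTop atTop := fun j hj =>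
    tendsto_nodeLen_atTop (j.zero_le.trans_lt hj) j hpos hlam
  choose v hsum henergy using fun n => exists_concat J (node_zero M (lam n))
    (node_add_nodeLen M (hpos n)) (fun j => b j (nodeLen M (lam n) j)) M
  refine ⟨v, fun n => ∑ j ∈ Finset.range M,
    lam n * nodeLen M (lam n) j * e j (nodeLen M (lam n) j), fun k hk => ?_, ?_, ?_⟩
  · simp only [hsum _ k hk, ← natCast_smul_meanSpin, Finset.smul_sum, smul_smul]
    refine tendsto_finsetSum _ fun j hj => ?_
    have hj : j < M := (Finset.mem_range.1 hj).trans_le hk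
    exact (tendsto_mul_nodeLen M j hpos hlam).smul ((hb j hj).comp (hlen j hj))
  · refine tendsto_finsetSum _ fun j hj => ?_
    have hj : j < M := Finset.mem_range.1 hj
    exact (tendsto_mul_nodeLen M j hpos hlam).mul ((he j hj).comp (hlen j hj))
  · filter_upwards [(Filter.eventually_all_finset (Finset.range M)).2 fun j hj =>
      (hlen j (Finset.mem_range.1 hj)).eventually (hbe j (Finset.mem_range.1 hj))] with n hn
    have hlam₀ := (hpos n).le
    simp only [mul_assoc, ← Finset.mul_sum]
    gcongr
    exact (henergy n).trans (Finset.sum_le_sum hn)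

lemma chainEnergy_le_partialEnergy (J : ℝ) {N : ℕ} {v w : Spins} (h : ∀ i, i ≠ N → w i = v i) :
    chainEnergy J N w ≤ partialEnergy J N v + 5 * (|J| + 1) := by
  have hpartial := abs_le.1 (abs_partialEnergy_sub_le J fun i (hi : i < N) => h i hi.ne)
  have hchain := abs_le.1 (abs_chainEnergy_sub_partialEnergy_le J N w)
  linarith

lemma tendsto_integral_interp (hpos : ∀ n, 0 < lam n) (hlam : Tendsto lam atTop (𝓝 0))
    {v : ℕ → Spins} {x : ℝ} (hx : 0 ≤ x) {z : Plane}
    (h : Tendsto (fun n => lam n • spinSum ⌊x / lam n⌋₊ (v n)) atTop (𝓝 z)) :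
    Tendsto (fun n => ∫ y in 0..x, interp (lam n) (v n) y) atTop (𝓝 z) := by
  have herror := squeeze_zero_norm (fun n => norm_integral_interp_sub_le (hpos n) (v n) hx) hlam
  simpa only [sub_add_cancel, zero_add] using herror.add h

lemma exists_periodic_config_tendsto (hM : 0 < M) (hpos : ∀ n, 0 < lam n)
    (hlam : Tendsto lam atTop (𝓝 0)) (hA : ∀ j < M, (A j, t j) ∈ homEpigraph J) :
    ∃ (v : ℕ → Spins) (e : ℕ → ℝ),
      (∀ k ≤ M, Tendsto (fun n => ∫ y in 0..(k / M : ℝ), interp (lam n) (v n) y) atTop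
        (𝓝 (∑ j ∈ Finset.range k, (M : ℝ)⁻¹ • A j))) ∧
      Tendsto e atTop (𝓝 (∑ j ∈ Finset.range M, (M : ℝ)⁻¹ * t j)) ∧
      ∀ᶠ n in atTop, PeriodicBC ⌊1 / lam n⌋₊ (v n) ∧
        lam n * chainEnergy J ⌊1 / lam n⌋₊ (v n) ≤ e n := by
  obtain ⟨v, e, hv, he, hve⟩ := exists_config_tendsto hpos hlam hA
  have hN : ∀ᶠ n in atTop, 2 ≤ ⌊1 / lam n⌋₊ := by
    filter_upwards [hlam.eventually_le_const (one_half_pos (α := ℝ))] with n hn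
    rw [Nat.le_floor_iff (one_div_nonneg.2 (hpos n).le), le_div_iff₀ (hpos n), Nat.cast_ofNat]
    linarith
  have : Nonempty Spins := ⟨v 0⟩
  choose! w hw hwv using fun n (hn : 2 ≤ ⌊1 / lam n⌋₊) => exists_periodicBC hn (v n)
  refine ⟨w, fun n => e n + lam n * (5 * (|J| + 1)), fun k hk => ?_, ?_, ?_⟩
  · refine tendsto_integral_interp hpos hlam (by positivity) ((hv k hk).congr' ?_)
    filter_upwards [hN] with n hn
    have hnode : node M (lam n) k ≤ ⌊1 / lam n⌋₊ :=
      (node_mono M (hpos n) hk).trans_eq (node_self hM _)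
    change lam n • spinSum (node M (lam n) k) (v n) = lam n • spinSum (node M (lam n) k) (w n)
    rw [spinSum_congr fun i hi => (hwv n hn i (hi.trans_le hnode).ne).symm]
  · simpa only [zero_mul, add_zero] using he.add (hlam.mul_const (5 * (|J| + 1)))
  · filter_upwards [hN, hve] with n hn hne
    rw [node_self hM] at hne
    refine ⟨hw n hn, ?_⟩
    have hle := mul_le_mul_of_nonneg_left (chainEnergy_le_partialEnergy J (hwv n hn)) (hpos n).le
    linarith

end Recovery

lemma integrable_homDensity_comp (J : ℝ) {w : ℝ → Plane} (hw : AEStronglyMeasurable w volI)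
    (hw₁ : ∀ᵐ x ∂volI, ‖w x‖ ≤ 1) : Integrable (fun x => homDensity J (w x)) volI :=
  integrable_comp_of_lowerSemicontinuousOn measurableSet_closedBall
    (lowerSemicontinuousOn_homDensity J)
    (fun _ hz => abs_homDensity_le J (mem_closedBall_zero_iff.1 hz)) hw.aemeasurable
    (by simpa only [mem_closedBall_zero_iff] using hw₁)

lemma cellMean_mem_homEpigraph (J : ℝ) {w : ℝ → Plane} (hw : Integrable w volI)
    (hw₁ : ∀ᵐ x ∂volI, ‖w x‖ ≤ 1) {M j : ℕ} (hj : j < M) :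
    (cellMean w M j, cellMean (fun x => homDensity J (w x)) M j) ∈ homEpigraph J := by
  have hf := integrable_homDensity_comp J hw.1 hw₁
  have hcell : Set.Ioc (j / M : ℝ) ((j + 1 : ℕ) / M) ⊆ Set.Ioc 0 1 :=
    Set.Ioc_subset_Ioc (natCast_div_mem_Icc hj.le).1 (natCast_div_mem_Icc (Nat.succ_le_of_lt hj)).2
  rw [volI_eq] at hw hf
  rw [cellMean, cellMean, ← average_pair (hw.mono_measure (Measure.restrict_mono_set _ hcell))
    (hf.mono_measure (Measure.restrict_mono_set _ hcell))]
  refine cellMean_mem (integrable_volI_iff.1 ?_) (convex_homEpigraph J) (isClosed_homEpigraph J)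
    (hw₁.mono fun x hx => homDensity_mem_homEpigraph J hx) hj
  rw [volI_eq]
  exact hw.prodMk hf

lemma eventually_exists_recovery (J : ℝ) {lam : ℕ → ℝ} (hpos : ∀ n, 0 < lam n)
    (hlam : Tendsto lam atTop (𝓝 0)) {w : ℝ → Plane} (hw : Integrable w volI)
    (hw₁ : ∀ᵐ x ∂volI, ‖w x‖ ≤ 1) {ε : ℝ} (hε : 0 < ε) :
    ∀ᶠ n in atTop, ∃ v, PeriodicBC ⌊1 / lam n⌋₊ v ∧
      lam n * chainEnergy J ⌊1 / lam n⌋₊ v ≤ ∫ x, homDensity J (w x) ∂volI + ε ∧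
      ∀ x ∈ Set.Icc (0 : ℝ) 1,
        ‖(∫ y in 0..x, interp (lam n) v y) - ∫ y in 0..x, w y‖ ≤ ε := by
  have hwI := integrable_volI_iff.1 hw
  have hfI := integrable_volI_iff.1 (integrable_homDensity_comp J hw.1 hw₁)
  obtain ⟨M, hMε⟩ := exists_nat_gt (2 / (ε / 2))
  have hM : (0 : ℝ) < M := (by positivity : (0 : ℝ) < 2 / (ε / 2)).trans hMε
  have hM₀ : 0 < M := Nat.cast_pos.1 hM
  obtain ⟨v, e, hv, he, hve⟩ := exists_periodic_config_tendsto hM₀ hpos hlam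
    fun j hj => cellMean_mem_homEpigraph J hw hw₁ hj
  simp only [← smul_eq_mul, sum_inv_smul_cellMean hfI le_rfl] at he
  rw [div_self hM.ne', ← integral_volI] at he
  have hnodes : ∀ᶠ n in atTop, ∀ k ∈ Finset.range (M + 1),
      ‖(∫ y in 0..(k / M : ℝ), interp (lam n) (v n) y) - ∫ y in 0..(k / M : ℝ), w y‖ ≤ ε / 2 := by
    refine (Filter.eventually_all_finset _).2 fun k hk => ?_
    have hk : k ≤ M := Finset.mem_range_succ_iff.1 hk
    have hlim := hv k hk
    rw [sum_inv_smul_cellMean hwI hk] at hlim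
    exact (tendsto_iff_norm_sub_tendsto_zero.1 hlim).eventually_le_const (half_pos hε)
  filter_upwards [hve, hnodes, he.eventually_le_const (lt_add_of_pos_right _ hε)]
    with n hn hnode hne
  refine ⟨v n, hn.1, hn.2.trans hne, fun x hx => ?_⟩
  have hle := norm_integral_sub_le_of_nodes hM₀ (intervalIntegrable_interp (lam n) (v n) 0 1)
    (ae_of_all _ fun y => (norm_interp _ _ y).le) hwI hw₁
    (fun k hk => hnode k (Finset.mem_range_succ_iff.2 hk)) hx
  have hmesh : 2 / (M : ℝ) < ε / 2 := (div_lt_comm₀ (half_pos hε) hM).1 hMε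
  linarith

lemma exists_LInfI_interp (lam : ℝ) (v : Spins) : ∃ u : LInfI, u =ᵐ[volI] interp lam v :=
  have h : MemLp (interp lam v) ⊤ volI :=
    memLp_top_of_bound (measurable_interp lam v).aestronglyMeasurable 1
      (ae_of_all _ fun x => (norm_interp lam v x).le)
  ⟨h.toLp _, h.coeFn_toLp⟩

lemma eventually_exists_LInfI_recovery (J : ℝ) {lam : ℕ → ℝ} (hpos : ∀ n, 0 < lam n)
    (hlam : Tendsto lam atTop (𝓝 0)) {w : ℝ → Plane} (hw : Integrable w volI)
    (hw₁ : ∀ᵐ x ∂volI, ‖w x‖ ≤ 1) {ε : ℝ} (hε : 0 < ε) :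
    ∀ᶠ n in atTop, ∃ u : {u : LInfI // ∀ᵐ x ∂volI, ‖u x‖ ≤ 1},
      energy J (lam n) u ≤ ((∫ x, homDensity J (w x) ∂volI + ε : ℝ) : EReal) ∧
      ∀ x ∈ Set.Icc (0 : ℝ) 1, ‖(∫ y in 0..x, u.1 y) - ∫ y in 0..x, w y‖ ≤ ε := by
  filter_upwards [eventually_exists_recovery J hpos hlam hw hw₁ hε] with n ⟨v, hv, hvE, hvw⟩
  obtain ⟨u, hu⟩ := exists_LInfI_interp (lam n) v
  refine ⟨⟨u, hu.mono fun x hx => by rw [hx, norm_interp]⟩, ?_, fun x hx => ?_⟩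
  · exact iInf_le_of_le v (iInf₂_le_of_le hv hu (EReal.coe_le_coe_iff.2 hvE))
  · rw [intervalIntegral_congr_volI hu hx]
    exact hvw x hx

lemma exists_recovery_sequence (J : ℝ) {lam : ℕ → ℝ} (hpos : ∀ n, 0 < lam n)
    (hlam : Tendsto lam atTop (𝓝 0)) (w : LInfI) :
    ∃ u : ℕ → LInfI, WeakStarTendsto u w ∧
      limsup (fun n => energy J (lam n) (u n)) atTop ≤ bulkEnergy (homDensity J) w := by
  by_cases hw₁ : ∀ᵐ x ∂volI, ‖w x‖ ≤ 1
  swap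
  · exact ⟨fun _ => w, fun g _ => tendsto_const_nhds, le_top.trans_eq (if_neg hw₁).symm⟩
  obtain ⟨ε, u, hε, hu⟩ := exists_seq_of_forall_eventually fun ε hε =>
    eventually_exists_LInfI_recovery J hpos hlam (integrable_of_LInfI w) hw₁ (ε := ε) hε
  refine ⟨fun n => u n, weakStarTendsto_of_tendsto_integral (fun n => (u n).2) hw₁ fun x hx => ?_,
    ?_⟩
  · exact tendsto_iff_norm_sub_tendsto_zero.2 (squeeze_zero'
      (Eventually.of_forall fun n => norm_nonneg _) (hu.mono fun n hn => hn.2 x hx) hε)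
  · have hlim : Tendsto (fun n => ((∫ x, homDensity J (w x) ∂volI + ε n : ℝ) : EReal)) atTop
        (𝓝 ((∫ x, homDensity J (w x) ∂volI : ℝ) : EReal)) :=
      EReal.tendsto_coe.2 (by simpa only [add_zero] using hε.const_add _)
    rw [bulkEnergy, if_pos hw₁, ← hlim.limsup_eq]
    exact limsup_le_limsup (hu.mono fun n hn => hn.1)

lemma bulkEnergy_zero (f : Plane → ℝ) : bulkEnergy f 0 = ((f 0 : ℝ) : EReal) := by
  have hzero : ((0 : LInfI) : ℝ → Plane) =ᵐ[volI] fun _ => 0 := Lp.coeFn_zero _ _ _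
  have hnorm : ∀ᵐ x ∂volI, ‖(0 : LInfI) x‖ ≤ 1 :=
    hzero.mono fun x hx => by rw [hx, norm_zero]; exact zero_le_one
  have hint : ∫ x, f ((0 : LInfI) x) ∂volI = ∫ _, f 0 ∂volI :=
    integral_congr_ae (hzero.fun_comp f)
  rw [bulkEnergy, if_pos hnorm, hint]
  simp

lemma coe_le_bulkEnergy {J c : ℝ} (hc : ∀ z : Plane, ‖z‖ ≤ 1 → c ≤ homDensity J z) (u : LInfI) :
    (c : EReal) ≤ bulkEnergy (homDensity J) u := by
  by_cases hu : ∀ᵐ x ∂volI, ‖u x‖ ≤ 1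
  · rw [bulkEnergy, if_pos hu, EReal.coe_le_coe_iff]
    have hle : ∫ _, c ∂volI ≤ ∫ x, homDensity J (u x) ∂volI :=
      integral_mono_ae (integrable_const _)
        (integrable_homDensity_comp J (integrable_of_LInfI u).1 hu) (hu.mono fun x hx => hc _ hx)
    simpa using hle
  · exact le_top.trans_eq (if_neg hu).symm

lemma bulkEnergy_zero_le {J : ℝ} (hJ : |J| ≤ 4) (u : LInfI) :
    bulkEnergy (homDensity J) 0 ≤ bulkEnergy (homDensity J) u := by
  rw [bulkEnergy_zero, homDensity_zero hJ]
  refine coe_le_bulkEnergy (fun z hz => ?_) u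
  have hbound := quadratic_le_homDensity J hz
  have hnonneg : 0 ≤ (J - 4) ^ 2 / 8 * ‖z‖ ^ 2 := by positivity
  linarith

end SpinChain

end

theorem theorem3p3_general (J₁ : ℝ) :
    ∃ fhom : SpinChain.Plane → ℝ,
      (∀ z ∈ Metric.closedBall (0 : SpinChain.Plane) 1, SpinChain.IsHomLimit J₁ z (fhom z)) ∧
      ConvexOn ℝ (Metric.closedBall (0 : SpinChain.Plane) 1) fhom ∧
      (∀ u : SpinChain.LInfI, (∀ᵐ x ∂SpinChain.volI, ‖u x‖ ≤ 1) →
        Integrable (fun x => fhom (u x)) SpinChain.volI) ∧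
      (∀ lam : ℕ → ℝ, (∀ n, 0 < lam n) → Tendsto lam atTop (𝓝 0) →
        SpinChain.IsGammaLimit (fun n => SpinChain.energy J₁ (lam n))
          (SpinChain.bulkEnergy fhom)) ∧
      (4 ≤ J₁ → ∀ z ∈ Metric.closedBall (0 : SpinChain.Plane) 1, fhom z = -(J₁ - 1)) ∧
      (|J₁| ≤ 4 → ∀ z ∈ Metric.closedBall (0 : SpinChain.Plane) 1,
        (J₁ - 4) ^ 2 / 8 * ‖z‖ ^ 2 ≤ fhom z + (1 + J₁ ^ 2 / 8) ∧
        fhom z + (1 + J₁ ^ 2 / 8) ≤ (J₁ - 4) ^ 2 / 8 * ‖z‖) ∧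
      (∃ h : ℝ → ℝ, ConvexOn ℝ (Set.Icc 0 1) h ∧ MonotoneOn h (Set.Icc 0 1) ∧
        ∀ z ∈ Metric.closedBall (0 : SpinChain.Plane) 1, fhom z = h ‖z‖) ∧
      (|J₁| ≤ 4 →
        SpinChain.bulkEnergy fhom 0 = ((-(1 + J₁ ^ 2 / 8) : ℝ) : EReal) ∧
        ∀ u : SpinChain.LInfI, SpinChain.bulkEnergy fhom 0 ≤ SpinChain.bulkEnergy fhom u) := by
  open SpinChain in
  obtain ⟨h, hh, hmono, hradial⟩ := exists_convexOn_monotoneOn_of_radial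
    (convexOn_homDensity J₁) fun _ _ => homDensity_eq_of_norm_eq J₁
  simp only [mem_closedBall_zero_iff]
  exact ⟨homDensity J₁, fun z hz => isHomLimit_homDensity J₁ (mem_closedBall_zero_iff.2 hz),
    convexOn_homDensity J₁, fun u => integrable_homDensity_comp J₁ (integrable_of_LInfI u).1,
    fun lam hpos hlam => ⟨fun _ _ => bulkEnergy_le_liminf_energy J₁ hpos hlam,
      exists_recovery_sequence J₁ hpos hlam⟩,
    fun hJ _ => homDensity_eq_of_four_le hJ,
    fun hJ z hz => ⟨quadratic_le_homDensity J₁ hz, homDensity_le_linear hJ hz⟩,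
    ⟨h, hh, hmono, fun z _ => hradial z⟩,
    fun hJ => ⟨by rw [bulkEnergy_zero, homDensity_zero hJ], bulkEnergy_zero_le hJ⟩⟩

theorem theorem3p3 (J₁ : ℝ) (hJ₁ : 0 ≤ J₁) :
    ∃ fhom : SpinChain.Plane → ℝ,
      -- the homogenization formula, on the closed unit ball
      (∀ z ∈ Metric.closedBall (0 : SpinChain.Plane) 1, SpinChain.IsHomLimit J₁ z (fhom z)) ∧
      ConvexOn ℝ (Metric.closedBall (0 : SpinChain.Plane) 1) fhom ∧
      -- the limit functional is given by a convergent integral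
      (∀ u : SpinChain.LInfI, (∀ᵐ x ∂SpinChain.volI, ‖u x‖ ≤ 1) →
        Integrable (fun x => fhom (u x)) SpinChain.volI) ∧
      -- Gamma-convergence, for every vanishing sequence of lattice spacings
      (∀ lam : ℕ → ℝ, (∀ n, 0 < lam n) → Tendsto lam atTop (𝓝 0) →
        SpinChain.IsGammaLimit (fun n => SpinChain.energy J₁ (lam n))
          (SpinChain.bulkEnergy fhom)) ∧
      -- (i)
      (4 ≤ J₁ → ∀ z ∈ Metric.closedBall (0 : SpinChain.Plane) 1, fhom z = -(J₁ - 1)) ∧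
      -- (ii)
      (0 < J₁ → J₁ ≤ 4 →
        (∀ z ∈ Metric.closedBall (0 : SpinChain.Plane) 1,
          (J₁ - 4) ^ 2 / 8 * ‖z‖ ^ 2 ≤ fhom z + (1 + J₁ ^ 2 / 8) ∧
          fhom z + (1 + J₁ ^ 2 / 8) ≤ (J₁ - 4) ^ 2 / 8 * ‖z‖) ∧
        ∃ h : ℝ → ℝ, ConvexOn ℝ (Set.Icc 0 1) h ∧ MonotoneOn h (Set.Icc 0 1) ∧
          ∀ z ∈ Metric.closedBall (0 : SpinChain.Plane) 1, fhom z = h ‖z‖) ∧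
      -- (iii)
      (0 < J₁ → J₁ ≤ 4 →
        SpinChain.bulkEnergy fhom 0 = ((-(1 + J₁ ^ 2 / 8) : ℝ) : EReal) ∧
        ∀ u : SpinChain.LInfI, SpinChain.bulkEnergy fhom 0 ≤ SpinChain.bulkEnergy fhom u) := by
  have habs : J₁ ≤ 4 → |J₁| ≤ 4 := (abs_of_nonneg hJ₁).trans_le
  obtain ⟨fhom, hlim, hconv, hint, hgamma, hfour, hbounds, hradial, hmin⟩ := theorem3p3_general J₁
  exact ⟨fhom, hlim, hconv, hint, hgamma, hfour, fun _ h4 => ⟨hbounds (habs h4), hradial⟩,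
    fun _ h4 => hmin (habs h4)⟩
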